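/- Let $K$ be a field of characteristic $0$, let $m\ge 2$, let $L_m$ be the free Lie algebra over $K$ with $m$ free generators, and let $F_m=L_m/L_m''$ be the free metabelian Lie algebra, with free generators $y_1,\dots,y_m$. Let $\widehat{F_m}$ be the completion of $F_m$ with respect to the formal power series topology, i.e. the topology defined by the powers $F_m\supseteq F_m^2\supseteq F_m^3\supseteq\cdots$. Let $\mathrm{IA}(\widehat{F_m})$ be the group of continuous automorphisms of $\widehat{F_m}$ which induce the identity map modulo the commutator ideal of $\widehat{F_m}$. Let $\mathrm{Inn}(\widehat{F_m})$ be the set of the automorphisms $\exp(\mathrm{ad}\,u)=\sum_{k\ge 0}(\mathrm{ad}\,u)^k/k!$, $u\in\widehat{F_m}$, where $v(\mathrm{ad}\,u)=[v,u]$. The abelian wreath product $W$ is the Lie algebra of all sums $\sum_{i=1}^m a_if_i(t_1,\dots,t_m)+\sum_{i=1}^m\beta_ib_i$ with $f_i\in K[t_1,\dots,t_m]$ and $\beta_i\in K$, with multiplication given by $[a_if,a_jg]=[b_i,b_j]=0$ and $[a_if,b_j]=a_i\,ft_j$. Let $\varepsilon:F_m\to W$ be the homomorphism with $\varepsilon(y_i)=a_i+b_i$.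 For $f\in F_m$ the partial derivative $\partial f/\partial y_i\in K[t_1,\dots,t_m]$ is the coefficient of $a_i$ in $\varepsilon(f)$; it extends by continuity to $\partial f/\partial y_i\in K[[t_1,\dots,t_m]]$ for $f\in\widehat{F_m}$. The Jacobian matrix of an automorphism $\phi$ of $\widehat{F_m}$ is $J(\phi)=\left(\partial\phi(y_j)/\partial y_i\right)_{i,j=1}^m$ ($i$ the row index, $j$ the column index). **Theorem.** Let $\Theta$ be the set of continuous automorphisms $\theta$ of $\widehat{F_m}$ with Jacobian matrix of the form $$ J(\theta)=I_m+\begin{pmatrix} s(t_2,\dots,t_m)&f_{12}&\cdots&f_{1m}\\ t_1q_2(t_2,t_3,\dots,t_m)+r_2(t_2,\dots,t_m)&f_{22}&\cdots&f_{2m}\\ t_1q_3(t_3,\dots,t_m)+r_3(t_2,\dots,t_m)&f_{32}&\cdots&f_{3m}\\ \vdots&\vdots&\ddots&\vdots\\ t_1q_m(t_m)+r_m(t_2,\dots,t_m)&f_{m2}&\cdots&f_{mm} \end{pmatrix}, $$ where $s,q_i,r_i,f_{ij}\in K[[t_1,\dots,t_m]]$ are formal power series without constant terms which satisfy $$ s+\sum_{i=2}^mt_iq_i=0,\qquad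 \sum_{i=2}^mt_ir_i=0,\qquad \sum_{i=1}^mt_if_{ij}=0,\quad j=2,\dots,m, $$ $s$ and the $r_i$ do not depend on $t_1$, $q_i$ does not depend on $t_1,\dots,t_{i-1}$ ($i=2,\dots,m$), and $f_{12}$ does not contain a summand $dt_2$ with $0\ne d\in K$. Then $\exp(\mathrm{ad}\,u)$ is an automorphism for every $u\in\widehat{F_m}$, $\mathrm{Inn}(\widehat{F_m})$ is a normal subgroup of $\mathrm{IA}(\widehat{F_m})$, $\Theta\subseteq\mathrm{IA}(\widehat{F_m})$, the cosets $\mathrm{Inn}(\widehat{F_m})\,\theta$, $\theta\in\Theta$, are pairwise disjoint (for distinct $\theta$), and their union is $\mathrm{IA}(\widehat{F_m})$. In other words, every element of the quotient group $\mathrm{IOut}(\widehat{F_m})=\mathrm{IA}(\widehat{F_m})/\mathrm{Inn}(\widehat{F_m})$ has exactly one representative in $\Theta$. -/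

import Mathlib

noncomputable section

namespace FreeMetab

/-! ### The free metabelian Lie algebra and its completion -/

/-- The free metabelian Lie algebra `F_m = L_m / L_m''` of rank `m` over `K`, where `L_m` is the
free Lie algebra on `m` generators. -/
abbrev F (m : ℕ) (K : Type*) [Field K] : Type _ :=
  FreeLieAlgebra K (Fin m) ⧸ LieAlgebra.derivedSeries K (FreeLieAlgebra K (Fin m)) 2

/-- The canonical free generator `y_i` of `F_m`. -/
def gen (m : ℕ) (K : Type*) [Field K] (i : Fin m) : F m K :=
  LieSubmodule.Quotient.mk (FreeLieAlgebra.of K i)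

/-- The `(k+1)`-st power `F_m^{k+1} = [F_m, …, F_m]` (`k + 1` factors) of `F_m`, as a Lie ideal. -/
abbrev pow (m : ℕ) (K : Type*) [Field K] (k : ℕ) : LieIdeal K (F m K) :=
  LieModule.lowerCentralSeries K (F m K) (F m K) k

/-- The inverse limit of the quotients `F_m / F_m^{k+1}`: the families `(x_k)_k` such that every
finite initial part `x_0, …, x_k` is given by the classes of one element of `F_m`. -/
def invLimit (m : ℕ) (K : Type*) [Field K] : Submodule K (∀ k : ℕ, F m K ⧸ pow m K k) where
  carrier := {x | ∀ k, ∃ v : F m K, ∀ l ≤ k, x l = LieSubmodule.Quotient.mk v}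
  zero_mem' := fun _ => ⟨0, fun _ _ => rfl⟩
  add_mem' := by
    intro x y hx hy k
    obtain ⟨v, hv⟩ := hx k
    obtain ⟨w, hw⟩ := hy k
    exact ⟨v + w, fun l hl => by rw [Pi.add_apply, hv l hl, hw l hl]; rfl⟩
  smul_mem' := by
    intro c x hx k
    obtain ⟨v, hv⟩ := hx k
    exact ⟨c • v, fun l hl => by rw [Pi.smul_apply, hv l hl]; rfl⟩

/-- The completion of `F_m` with respect to the formal power series topology, i.e. the topology
given by the powers `F_m ⊇ F_m^2 ⊇ F_m^3 ⊇ ⋯`. -/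
abbrev Fhat (m : ℕ) (K : Type*) [Field K] : Type _ := invLimit m K

section instances

variable (m : ℕ) (K : Type*) [Field K]

/-- The Lie product on the completion is the componentwise one. -/
instance : Bracket (Fhat m K) (Fhat m K) where
  bracket x y := ⟨fun k => ⁅x.1 k, y.1 k⁆, fun k => by
    obtain ⟨v, hv⟩ := x.2 k
    obtain ⟨w, hw⟩ := y.2 k
    exact ⟨⁅v, w⁆, fun l hl => by change ⁅x.1 l, y.1 l⁆ = _; rw [hv l hl, hw l hl]; rfl⟩⟩

instance : LieRing (Fhat m K) where
  add_lie x y z := Subtype.ext (funext fun k => add_lie (x.1 k) (y.1 k) (z.1 k))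
  lie_add x y z := Subtype.ext (funext fun k => lie_add (x.1 k) (y.1 k) (z.1 k))
  lie_self x := Subtype.ext (funext fun k => lie_self (x.1 k))
  leibniz_lie x y z := Subtype.ext (funext fun k => leibniz_lie (x.1 k) (y.1 k) (z.1 k))

instance : LieAlgebra K (Fhat m K) where
  lie_smul c x y := Subtype.ext (funext fun k => lie_smul c (x.1 k) (y.1 k))

/-- The projection of the completion onto `F_m / F_m^{k+1}`. -/
def proj (k : ℕ) (x : Fhat m K) : F m K ⧸ pow m K k := x.1 k

/-- The formal power series topology on the completion: the inverse limit topology of the discrete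
quotients `F_m / F_m^{k+1}`. -/
instance : TopologicalSpace (Fhat m K) := ⨅ k : ℕ, TopologicalSpace.induced (proj m K k) ⊥

end instances

/-- The canonical map from `F_m` to its completion. -/
def toHat (m : ℕ) (K : Type*) [Field K] (v : F m K) : Fhat m K :=
  ⟨fun _ => LieSubmodule.Quotient.mk v, fun _ => ⟨v, fun _ _ => rfl⟩⟩

/-! ### The abelian wreath product -/

/-- The abelian wreath product `A_m wr B_m`. The element `⟨f, β⟩` stands for
`∑ i, a_i f_i(t_1, …, t_m) + ∑ i, β_i b_i`. -/
@[ext] structure Wreath (m : ℕ) (K : Type*) [Field K] where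
  /-- The coefficients of the `a_i`. -/
  a : Fin m → MvPolynomial (Fin m) K
  /-- The coefficients of the `b_i`. -/
  b : Fin m → K

namespace Wreath

variable {m : ℕ} {K : Type*} [Field K]

/-- As a type, the wreath product is a product. -/
def toProd : Wreath m K ≃ (Fin m → MvPolynomial (Fin m) K) × (Fin m → K) where
  toFun x := ⟨x.a, x.b⟩
  invFun x := ⟨x.1, x.2⟩
  left_inv _ := rfl
  right_inv _ := rfl

instance : AddCommGroup (Wreath m K) := toProd.addCommGroup

instance : Module K (Wreath m K) := toProd.module K

/-- The linear form `∑ j, β_j t_j`. -/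
def lin (β : Fin m → K) : MvPolynomial (Fin m) K := ∑ j, β j • MvPolynomial.X j

/-- The Lie product determined by `[a_i f, b_j] = a_i f t_j`, while all products of two `a`-parts
and of two `b`-parts vanish. -/
instance : Bracket (Wreath m K) (Wreath m K) where
  bracket x y := ⟨fun i => x.a i * lin y.b - y.a i * lin x.b, 0⟩

theorem zero_a : (0 : Wreath m K).a = 0 := rfl
theorem zero_b : (0 : Wreath m K).b = 0 := rfl
theorem add_a (x y : Wreath m K) : (x + y).a = x.a + y.a := rfl
theorem add_b (x y : Wreath m K) : (x + y).b = x.b + y.b := rfl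
theorem smul_a (c : K) (x : Wreath m K) : (c • x).a = c • x.a := rfl
theorem smul_b (c : K) (x : Wreath m K) : (c • x).b = c • x.b := rfl
theorem lie_a (x y : Wreath m K) (i : Fin m) :
    ⁅x, y⁆.a i = x.a i * lin y.b - y.a i * lin x.b := rfl
theorem lie_b (x y : Wreath m K) : ⁅x, y⁆.b = 0 := rfl

theorem lin_zero : lin (0 : Fin m → K) = 0 := by simp [lin]
theorem lin_add (β γ : Fin m → K) : lin (β + γ) = lin β + lin γ := by
  simp [lin, add_smul, Finset.sum_add_distrib]
theorem lin_smul (c : K) (β : Fin m → K) : lin (c • β) = c • lin β := by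
  simp [lin, Finset.smul_sum, mul_smul]

instance : LieRing (Wreath m K) where
  add_lie x y z := by
    ext1
    · funext i
      simp only [lie_a, add_a, add_b, lin_add, Pi.add_apply]; ring
    · simp [lie_b, add_b]
  lie_add x y z := by
    ext1
    · funext i
      simp only [lie_a, add_a, add_b, lin_add, Pi.add_apply]; ring
    · simp [lie_b, add_b]
  lie_self x := by
    ext1
    · funext i
      simp only [lie_a, zero_a, Pi.zero_apply]; ring
    · rfl
  leibniz_lie x y z := by
    ext1
    · funext i
      simp only [lie_a, add_a, lie_b, lin_zero, Pi.add_apply]; ring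
    · simp [lie_b, add_b]

instance : LieAlgebra K (Wreath m K) where
  lie_smul c x y := by
    ext1
    · funext i
      simp only [lie_a, smul_a, smul_b, lin_smul, Pi.smul_apply, smul_sub, mul_smul_comm,
        smul_mul_assoc]
    · simp [lie_b, smul_b]

end Wreath

section embedding

variable (m : ℕ) (K : Type*) [Field K]

/-- The homomorphism `L_m → A_m wr B_m` with `x_i ↦ a_i + b_i`. -/
def freeToWreath : FreeLieAlgebra K (Fin m) →ₗ⁅K⁆ Wreath m K :=
  FreeLieAlgebra.lift K fun i => ⟨Pi.single i 1, Pi.single i 1⟩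

theorem freeToWreath_derived_one :
    ∀ x ∈ LieAlgebra.derivedSeries K (FreeLieAlgebra K (Fin m)) 1, (freeToWreath m K x).b = 0 := by
  intro x hx
  rw [LieAlgebra.derivedSeries_def, LieAlgebra.derivedSeriesOfIdeal_succ,
    LieAlgebra.derivedSeriesOfIdeal_zero, ← LieSubmodule.mem_toSubmodule,
    LieSubmodule.lieIdeal_oper_eq_linear_span'] at hx
  induction hx using Submodule.span_induction with
  | mem x h => obtain ⟨u, -, v, -, rfl⟩ := h; rw [LieHom.map_lie]; rfl
  | zero => rw [map_zero]; rfl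
  | add x y _ _ hx hy => rw [map_add, Wreath.add_b, hx, hy, add_zero]
  | smul c x _ hx => rw [map_smul, Wreath.smul_b, hx, smul_zero]

theorem freeToWreath_derived_two :
    LieAlgebra.derivedSeries K (FreeLieAlgebra K (Fin m)) 2 ≤ (freeToWreath m K).ker := by
  intro x hx
  rw [LieHom.mem_ker]
  rw [LieAlgebra.derivedSeries_def, LieAlgebra.derivedSeriesOfIdeal_succ,
    ← LieSubmodule.mem_toSubmodule, LieSubmodule.lieIdeal_oper_eq_linear_span'] at hx
  induction hx using Submodule.span_induction with
  | mem x h =>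
    obtain ⟨u, hu, v, hv, rfl⟩ := h
    rw [LieHom.map_lie]
    ext1
    · funext i
      rw [Wreath.lie_a, freeToWreath_derived_one m K u hu, freeToWreath_derived_one m K v hv,
        Wreath.lin_zero]
      simp [Wreath.zero_a]
    · rfl
  | zero => exact map_zero _
  | add x y _ _ hx hy => rw [map_add, hx, hy, add_zero]
  | smul c x _ hx => rw [map_smul, hx, smul_zero]

/-- The embedding `ε : F_m → A_m wr B_m` with `ε(y_i) = a_i + b_i`. -/
def eps : F m K →ₗ[K] Wreath m K :=
  Submodule.liftQ _ (freeToWreath m K).toLinearMap fun _ hx => freeToWreath_derived_two m K hx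

theorem eps_gen (i : Fin m) : eps m K (gen m K i) = ⟨Pi.single i 1, Pi.single i 1⟩ :=
  FreeLieAlgebra.lift_of_apply _ i

theorem eps_lie (u v : F m K) : eps m K ⁅u, v⁆ = ⁅eps m K u, eps m K v⁆ := by
  obtain ⟨u, rfl⟩ := LieSubmodule.Quotient.surjective_mk' _ u
  obtain ⟨v, rfl⟩ := LieSubmodule.Quotient.surjective_mk' _ v
  exact (freeToWreath m K).map_lie u v

/-- The linear functional sending `f ∈ F_m` to the coefficient of `t^d` in the partial derivative
`∂f/∂y_i`, i.e. in the coefficient of `a_i` in `ε(f)`. -/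
def pderivCoeff (i : Fin m) (d : Fin m →₀ ℕ) : F m K →ₗ[K] K where
  toFun f := MvPolynomial.coeff d ((eps m K f).a i)
  map_add' f g := by rw [map_add, Wreath.add_a]; simp
  map_smul' c f := by rw [map_smul, Wreath.smul_a]; simp

theorem coeff_mul_lin (p : MvPolynomial (Fin m) K) (β : Fin m → K) (k : ℕ)
    (hp : ∀ d : Fin m →₀ ℕ, d.degree < k → p.coeff d = 0) (d : Fin m →₀ ℕ)
    (hd : d.degree < k + 1) : (p * Wreath.lin β).coeff d = 0 := by
  rw [Wreath.lin, Finset.mul_sum, MvPolynomial.coeff_sum]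
  refine Finset.sum_eq_zero fun j _ => ?_
  rw [mul_smul_comm, MvPolynomial.coeff_smul, MvPolynomial.coeff_mul_X']
  split_ifs with h
  · rw [hp, smul_zero]
    have h1 : Finsupp.single j 1 ≤ d := by
      rw [Finsupp.single_le_iff]
      exact Nat.one_le_iff_ne_zero.mpr (Finsupp.mem_support_iff.mp h)
    have h2 := congrArg Finsupp.degree (tsub_add_cancel_of_le h1)
    rw [map_add, Finsupp.degree_single] at h2
    omega
  · exact smul_zero _

/-- The elements of `F_m^{k+1}` have partial derivatives without terms of degree less than `k`. -/
theorem pderivCoeff_pow (k : ℕ) : ∀ f ∈ pow m K k, (k ≠ 0 → (eps m K f).b = 0) ∧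
    ∀ (i : Fin m) (d : Fin m →₀ ℕ), d.degree < k → pderivCoeff m K i d f = 0 := by
  induction k with
  | zero => exact fun f _ => ⟨fun h => absurd rfl h, fun i d hd => absurd hd (Nat.not_lt_zero _)⟩
  | succ k ih =>
    intro f hf
    rw [pow, LieModule.lowerCentralSeries_succ, ← LieSubmodule.mem_toSubmodule,
      LieSubmodule.lieIdeal_oper_eq_linear_span'] at hf
    induction hf using Submodule.span_induction with
    | mem x h =>
      obtain ⟨u, -, v, hv, rfl⟩ := h
      obtain ⟨hb, ha⟩ := ih v hv
      refine ⟨fun _ => by rw [eps_lie]; rfl, fun i d hd => ?_⟩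
      change MvPolynomial.coeff d ((eps m K ⁅u, v⁆).a i) = 0
      rw [eps_lie, Wreath.lie_a, MvPolynomial.coeff_sub]
      have h1 := coeff_mul_lin m K ((eps m K v).a i) (eps m K u).b k (ha i) d hd
      rw [h1, sub_zero]
      rcases Nat.eq_zero_or_pos k with rfl | hk
      · exact coeff_mul_lin m K _ _ 0 (fun d hd => absurd hd (Nat.not_lt_zero _)) d hd
      · rw [hb hk.ne', Wreath.lin_zero, mul_zero, MvPolynomial.coeff_zero]
    | zero => exact ⟨fun _ => by rw [map_zero]; rfl, fun i d _ => map_zero _⟩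
    | add x y _ _ hx hy =>
      exact ⟨fun h => by rw [map_add, Wreath.add_b, hx.1 h, hy.1 h, add_zero],
        fun i d hd => by rw [map_add, hx.2 i d hd, hy.2 i d hd, add_zero]⟩
    | smul c x _ hx =>
      exact ⟨fun h => by rw [map_smul, Wreath.smul_b, hx.1 h, smul_zero],
        fun i d hd => by rw [map_smul, hx.2 i d hd, smul_zero]⟩

/-- The partial derivative `∂x/∂y_i ∈ K[[t_1, …, t_m]]` of an element `x` of the completion: the
continuous extension of the partial derivative on `F_m`. The coefficient of `t^d` is that of the
partial derivative of any element of `F_m` congruent to `x` modulo terms of degree greater than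
`deg d + 1`. -/
def pderiv (i : Fin m) (x : Fhat m K) : MvPowerSeries (Fin m) K := fun d =>
  Submodule.liftQ (pow m K (d.degree + 1)).toSubmodule (pderivCoeff m K i d)
    (fun f hf => (pderivCoeff_pow m K (d.degree + 1) f hf).2 i d (Nat.lt_succ_self _))
    (proj m K (d.degree + 1) x)

theorem coeff_pderiv_toHat (i : Fin m) (f : F m K) (d : Fin m →₀ ℕ) :
    MvPowerSeries.coeff d (pderiv m K i (toHat m K f)) = ((eps m K f).a i).coeff d := rfl

end embedding

/-! ### Automorphisms -/

section automorphisms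

variable (m : ℕ) (K : Type*) [Field K]

/-- The group of continuous automorphisms of the completion: the bicontinuous linear bijections
that preserve the Lie product; multiplication is the composition `(φψ)(x) = φ(ψ(x))`. -/
def contAut : Subgroup (Fhat m K ≃L[K] Fhat m K) where
  carrier := {φ | ∀ u v : Fhat m K, φ ⁅u, v⁆ = ⁅φ u, φ v⁆}
  one_mem' := fun _ _ => rfl
  mul_mem' := by
    intro φ ψ hφ hψ u v
    change φ (ψ ⁅u, v⁆) = ⁅φ (ψ u), φ (ψ v)⁆
    rw [hψ, hφ]
  inv_mem' := by
    intro φ hφ u v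
    change φ.symm ⁅u, v⁆ = ⁅φ.symm u, φ.symm v⁆
    apply φ.injective
    rw [hφ]
    simp

/-- The commutator ideal of the completion is invariant under every automorphism. -/
theorem map_mem_derived (φ : Fhat m K ≃L[K] Fhat m K) (hφ : φ ∈ contAut m K) (u : Fhat m K)
    (hu : u ∈ LieAlgebra.derivedSeries K (Fhat m K) 1) :
    φ u ∈ LieAlgebra.derivedSeries K (Fhat m K) 1 := by
  rw [LieAlgebra.derivedSeries_def, LieAlgebra.derivedSeriesOfIdeal_succ,
    LieAlgebra.derivedSeriesOfIdeal_zero, ← LieSubmodule.mem_toSubmodule,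
    LieSubmodule.lieIdeal_oper_eq_linear_span'] at hu ⊢
  induction hu using Submodule.span_induction with
  | mem x h =>
    obtain ⟨a, -, b, -, rfl⟩ := h
    exact Submodule.subset_span ⟨φ a, trivial, φ b, trivial, (hφ a b).symm⟩
  | zero => rw [map_zero]; exact zero_mem _
  | add x y _ _ hx hy => rw [map_add]; exact add_mem hx hy
  | smul c x _ hx => rw [map_smul]; exact Submodule.smul_mem _ c hx

/-- The group of continuous IA-automorphisms of the completion: those inducing the identity map
modulo the commutator ideal. -/
def IA : Subgroup (Fhat m K ≃L[K] Fhat m K) where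
  carrier := {φ | φ ∈ contAut m K ∧
    ∀ u : Fhat m K, φ u - u ∈ LieAlgebra.derivedSeries K (Fhat m K) 1}
  one_mem' := ⟨one_mem _, fun u => by
    change u - u ∈ _
    rw [sub_self]; exact zero_mem _⟩
  mul_mem' := by
    intro φ ψ hφ hψ
    refine ⟨mul_mem hφ.1 hψ.1, fun u => ?_⟩
    change φ (ψ u) - u ∈ _
    have h := add_mem (hφ.2 (ψ u)) (hψ.2 u)
    rwa [sub_add_sub_cancel] at h
  inv_mem' := by
    intro φ hφ
    refine ⟨inv_mem hφ.1, fun u => ?_⟩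
    change φ.symm u - u ∈ _
    have h := neg_mem (hφ.2 (φ.symm u))
    rw [neg_sub] at h
    simpa using h

variable {m K}

/-- `φ = exp(ad u)`, where `v (ad u) = [v, u]`: for every `v` the series
`∑ k, (v adᵏ u) / k!` converges to `φ v`. -/
def IsExpAd (u : Fhat m K) (φ : Fhat m K ≃L[K] Fhat m K) : Prop :=
  ∀ v : Fhat m K, HasSum (fun k : ℕ => (k.factorial : K)⁻¹ • (fun w : Fhat m K => ⁅w, u⁆)^[k] v) (φ v)

variable (m K)

/-- The set of inner automorphisms `exp(ad u)` of the completion. -/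
def Inn : Set (Fhat m K ≃L[K] Fhat m K) := {φ | φ ∈ contAut m K ∧ ∃ u : Fhat m K, IsExpAd u φ}

variable {m K}

/-- The Jacobian matrix `J(φ) = (∂φ(y_j)/∂y_i)`, with row index `i` and column index `j`. -/
def jacobian (φ : Fhat m K ≃L[K] Fhat m K) : Matrix (Fin m) (Fin m) (MvPowerSeries (Fin m) K) :=
  Matrix.of fun i j => pderiv m K i (φ (toHat m K (gen m K j)))

/-- The power series `f` involves only the variables `t_j` with `j ∈ S`. -/
def InVars (S : Set (Fin m)) (f : MvPowerSeries (Fin m) K) : Prop :=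
  ∀ d : Fin m →₀ ℕ, MvPowerSeries.coeff d f ≠ 0 → ∀ j, d j ≠ 0 → j ∈ S

/-- The prescribed form of a Jacobian matrix, for `m ≥ 2`. The indices `0, 1 : Fin m` stand for the
indices `1, 2` in the usual notation `t_1, …, t_m`. -/
def HasNormalForm (hm : 2 ≤ m) (J : Matrix (Fin m) (Fin m) (MvPowerSeries (Fin m) K)) : Prop :=
  let i₁ : Fin m := ⟨0, by omega⟩
  let i₂ : Fin m := ⟨1, by omega⟩
  let t : Fin m → MvPowerSeries (Fin m) K := fun i => MvPowerSeries.X i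
  ∃ (s : MvPowerSeries (Fin m) K) (q r : Fin m → MvPowerSeries (Fin m) K)
    (f : Fin m → Fin m → MvPowerSeries (Fin m) K),
    (J = 1 + Matrix.of fun i j =>
      if j = i₁ then (if i = i₁ then s else t i₁ * q i + r i) else f i j) ∧
    -- there are no constant terms
    MvPowerSeries.constantCoeff s = 0 ∧
    (∀ i > i₁, MvPowerSeries.constantCoeff (q i) = 0 ∧ MvPowerSeries.constantCoeff (r i) = 0) ∧
    (∀ i, ∀ j > i₁, MvPowerSeries.constantCoeff (f i j) = 0) ∧
    -- the variables that may occur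
    InVars {l | i₁ < l} s ∧
    (∀ i > i₁, InVars {l | i ≤ l} (q i)) ∧
    (∀ i > i₁, InVars {l | i₁ < l} (r i)) ∧
    -- the linear relations
    s + ∑ i ∈ Finset.Ioi i₁, t i * q i = 0 ∧
    ∑ i ∈ Finset.Ioi i₁, t i * r i = 0 ∧
    (∀ j > i₁, ∑ i, t i * f i j = 0) ∧
    -- `f_{12}` has no summand `d t_2`
    MvPowerSeries.coeff (Finsupp.single i₂ 1) (f i₁ i₂) = 0

variable (m K)

/-- The set `Θ` of the continuous automorphisms of the completion whose Jacobian matrix has the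
prescribed form. -/
def Theta (hm : 2 ≤ m) : Set (Fhat m K ≃L[K] Fhat m K) :=
  {θ | θ ∈ contAut m K ∧ HasNormalForm hm (jacobian θ)}

end automorphisms

end FreeMetab

end

/-!
Write `t` for the row `(t_1, …, t_m)` of the variables. Everything is reduced to linear algebra over
`K[[t_1, …, t_m]]`.

*The completion.* The gradient `x ↦ (∂x/∂y_1, …, ∂x/∂y_m)` identifies the completion with the set of
vectors `f` of power series such that `∑ t_i (f_i - f_i(0)) = 0`, and `F_m^{k+1}` with the condition
that all terms of degree less than `k` vanish (`grad_injective`, `exists_grad_eq`, `proj_eq_iff`).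
This rests on a contracting homotopy of the Koszul complex coming from Euler's identity,
`a_i t^d ↦ ∑_k d_k / (|d| + 1) t^{d - e_k} [y_i, y_k]`: by the Jacobi identity it is a left inverse
of `F_m' → ⨁ a_i K[t]` (`homotopy_eps`), and it is a right inverse on the syzygies of the variables
(`eps_homotopy`). Euler's identity also shows that the commutator ideal of the completion consists
of the elements whose gradient has no constant terms (`mem_derived_iff`).

*Automorphisms.* By the chain rule an IA-automorphism acts on gradients as multiplication by its
Jacobian matrix, and the matrices `J` that occur are those with `J(0) = 1` and `t J = t`
(`grad_apply`, `mem_IA_iff`, `exists_mem_IA_of_matrix`). Summing the exponential series shows that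
`exp(ad u)` has the matrix `e^ℓ - w t` with `ℓ = ∑ u_i(0) t_i` and `w = (e^ℓ - 1) / ℓ · grad u`; so
inner automorphisms correspond to the matrices `e^ℓ - w t` with `ℓ` a linear form and
`t w = e^ℓ - 1` (`mem_Inn_iff`). From `t J = t` one reads off that these form a normal subgroup.

*Normal form.* Multiplication of `J` by such a matrix gives `e^ℓ J - w t`, which changes the first
column by a multiple of `t_1`. The condition on `f_{12}` determines the coefficient of `t_1` in `ℓ`,
the vanishing of the constant terms of the `q_i` determines the other coefficients, and then `w` is
determined by the first column, because `-s` has exactly one decomposition `∑ t_i q_i` with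
`q_i ∈ K[[t_i, …, t_m]]` (`exists_inn_mul_hasNormalForm`, `hasNormalForm_unique`).
-/

noncomputable section

namespace FreeMetab

/-! ### The commutator ideal of the free metabelian Lie algebra as a module -/

section algebra

variable {m : ℕ} {K : Type*} [Field K]

/-- A Lie subalgebra of `F_m` containing the free generators is everything. -/
theorem lieSubalgebra_eq_top (S : LieSubalgebra K (F m K)) (hS : ∀ i, gen m K i ∈ S) (v : F m K) :
    v ∈ S := by
  obtain ⟨x, rfl⟩ := LieSubmodule.Quotient.surjective_mk' _ v
  let g : FreeLieAlgebra K (Fin m) →ₗ⁅K⁆ S := FreeLieAlgebra.lift K fun i => ⟨gen m K i, hS i⟩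
  let q : FreeLieAlgebra K (Fin m) →ₗ⁅K⁆ F m K :=
    { (LieSubmodule.Quotient.mk' (LieAlgebra.derivedSeries K (FreeLieAlgebra K (Fin m)) 2) :
        FreeLieAlgebra K (Fin m) →ₗ[K] F m K) with
      map_lie' := fun {_ _} => rfl }
  have h : S.incl.comp g = q := by
    refine FreeLieAlgebra.hom_ext fun i => ?_
    rw [LieHom.comp_apply, FreeLieAlgebra.lift_of_apply]
    rfl
  have h2 := LieHom.congr_fun h x
  change q x ∈ S
  rw [← h2]
  exact (g x).2

theorem lie_mem_pow_one (a b : F m K) : ⁅a, b⁆ ∈ pow m K 1 :=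
  LieSubmodule.lie_mem_lie (LieSubmodule.mem_top a) (LieSubmodule.mem_top b)

theorem lie_mem_pow_succ {k : ℕ} {v : F m K} (hv : v ∈ pow m K k) (w : F m K) :
    ⁅v, w⁆ ∈ pow m K (k + 1) := by
  rw [← lie_skew, pow, LieModule.lowerCentralSeries_succ]
  exact neg_mem (LieSubmodule.lie_mem_lie (LieSubmodule.mem_top w) hv)

theorem pow_one_induction {p : F m K → Prop} (lie : ∀ a b : F m K, p ⁅a, b⁆) (zero : p 0)
    (add : ∀ a b, p a → p b → p (a + b)) (smul : ∀ (c : K) a, p a → p (c • a)) {v : F m K}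
    (hv : v ∈ pow m K 1) : p v := by
  rw [pow, LieModule.lowerCentralSeries_succ, ← LieSubmodule.mem_toSubmodule,
    LieSubmodule.lieIdeal_oper_eq_linear_span'] at hv
  induction hv using Submodule.span_induction with
  | mem x h => obtain ⟨u, -, v, -, rfl⟩ := h; exact lie u v
  | zero => exact zero
  | add x y _ _ hx hy => exact add x y hx hy
  | smul c x _ hx => exact smul c x hx

theorem lie_lie_lie (a b c d : F m K) : ⁅⁅a, b⁆, ⁅c, d⁆⁆ = 0 := by
  obtain ⟨a, rfl⟩ := LieSubmodule.Quotient.surjective_mk' _ a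
  obtain ⟨b, rfl⟩ := LieSubmodule.Quotient.surjective_mk' _ b
  obtain ⟨c, rfl⟩ := LieSubmodule.Quotient.surjective_mk' _ c
  obtain ⟨d, rfl⟩ := LieSubmodule.Quotient.surjective_mk' _ d
  refine (LieSubmodule.Quotient.mk_eq_zero' (N := LieAlgebra.derivedSeries K
    (FreeLieAlgebra K (Fin m)) 2) (m := ⁅⁅a, b⁆, ⁅c, d⁆⁆)).mpr ?_
  have h : ∀ x y : FreeLieAlgebra K (Fin m),
      ⁅x, y⁆ ∈ LieAlgebra.derivedSeries K (FreeLieAlgebra K (Fin m)) 1 := fun x y =>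
    LieSubmodule.lie_mem_lie (LieSubmodule.mem_top x) (LieSubmodule.mem_top y)
  exact LieSubmodule.lie_mem_lie (h a b) (h c d)

theorem lie_eq_zero_of_mem {v w : F m K} (hv : v ∈ pow m K 1) (hw : w ∈ pow m K 1) :
    ⁅v, w⁆ = 0 := by
  refine pow_one_induction (p := fun v => ⁅v, w⁆ = 0) (fun a b => ?_) (zero_lie w)
    (fun x y hx hy => by rw [add_lie, hx, hy, add_zero])
    (fun c x hx => by rw [smul_lie, hx, smul_zero]) hv
  exact pow_one_induction (p := fun w => ⁅⁅a, b⁆, w⁆ = 0) (fun c d => lie_lie_lie a b c d)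
    (lie_zero _) (fun x y hx hy => by rw [lie_add, hx, hy, add_zero])
    (fun c x hx => by rw [lie_smul, hx, smul_zero]) hw

/-- The operator `v ↦ [v, y_j]` on the commutator ideal `F_m'`; it is multiplication by `t_j` for
the natural structure of a `K[t_1, …, t_m]`-module on `F_m'`. -/
def radGen (j : Fin m) : Module.End K (pow m K 1) where
  toFun v := ⟨⁅(v : F m K), gen m K j⁆, lie_mem_pow_one _ _⟩
  map_add' v w := Subtype.ext (add_lie (v : F m K) w (gen m K j))
  map_smul' c v := Subtype.ext (smul_lie c (v : F m K) (gen m K j))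

theorem coe_radGen (j : Fin m) (v : pow m K 1) :
    (radGen j v : F m K) = ⁅(v : F m K), gen m K j⁆ := rfl

theorem radGen_commute (i j : Fin m) : Commute (radGen (K := K) i) (radGen j) := by
  refine LinearMap.ext fun v => Subtype.ext ?_
  change ⁅⁅(v : F m K), gen m K j⁆, gen m K i⁆ = ⁅⁅(v : F m K), gen m K i⁆, gen m K j⁆
  have h := lie_eq_zero_of_mem v.2 (lie_mem_pow_one (gen m K j) (gen m K i))
  rw [leibniz_lie, ← lie_skew (gen m K j), ← sub_eq_add_neg, sub_eq_zero] at h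
  exact h

theorem pairwise_commute_powersHom : Pairwise fun i j : Fin m => ∀ x y : Multiplicative ℕ,
    Commute (powersHom _ (radGen (K := K) i) x) (powersHom _ (radGen (K := K) j) y) := by
  intro i j _ x y
  simp only [powersHom_apply]
  exact (radGen_commute i j).pow_pow _ _

/-- Multiplication by the monomial `t^d` on `F_m'`. -/
def radMon (d : Fin m →₀ ℕ) : Module.End K (pow m K 1) :=
  MonoidHom.noncommPiCoprod (N := fun _ : Fin m => Multiplicative ℕ)
    (fun j => powersHom _ (radGen j)) pairwise_commute_powersHom
    (fun j => Multiplicative.ofAdd (d j))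

theorem radMon_add (d e : Fin m →₀ ℕ) : radMon (K := K) (d + e) = radMon d * radMon e := by
  unfold radMon
  rw [← map_mul]
  rfl

theorem radMon_zero : radMon (K := K) (0 : Fin m →₀ ℕ) = 1 := by
  unfold radMon
  exact map_one _

theorem radMon_single (j : Fin m) : radMon (K := K) (Finsupp.single j 1) = radGen j := by
  unfold radMon
  have : (fun i => Multiplicative.ofAdd (Finsupp.single j 1 i)) =
      Pi.mulSingle (M := fun _ : Fin m => Multiplicative ℕ) j (Multiplicative.ofAdd 1) := by
    funext i
    by_cases h : i = j
    · subst h; simp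
    · rw [Pi.mulSingle_eq_of_ne h, Finsupp.single_eq_of_ne h]; rfl
  rw [this, MonoidHom.noncommPiCoprod_mulSingle]
  simp [powersHom_apply]

theorem radMon_add_single (d : Fin m →₀ ℕ) (j : Fin m) (v : pow m K 1) :
    radMon (d + Finsupp.single j 1) v = radGen j (radMon d v) := by
  rw [add_comm, radMon_add, radMon_single]; rfl

/-- Induction on multi-indices, raising one exponent at a time. -/
theorem multiIndex_induction {p : (Fin m →₀ ℕ) → Prop} (zero : p 0)
    (add_single : ∀ d j, p d → p (d + Finsupp.single j 1)) (d : Fin m →₀ ℕ) : p d := by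
  obtain ⟨n, hn⟩ : ∃ n, d.degree = n := ⟨_, rfl⟩
  induction n generalizing d with
  | zero => rw [(Finsupp.degree_eq_zero_iff d).mp hn]; exact zero
  | succ n ih =>
    obtain ⟨j, hj⟩ : ∃ j, d j ≠ 0 := by
      by_contra! h
      rw [Finsupp.ext (g := 0) h] at hn
      simp at hn
    have h1 : d - Finsupp.single j 1 + Finsupp.single j 1 = d :=
      tsub_add_cancel_of_le (Finsupp.single_le_iff.mpr (Nat.one_le_iff_ne_zero.mpr hj))
    rw [← h1]
    refine add_single _ _ (ih _ ?_)
    have h2 := congrArg Finsupp.degree h1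
    rw [map_add, Finsupp.degree_single] at h2
    omega

theorem coe_radMon_mem (d : Fin m →₀ ℕ) (v : pow m K 1) :
    (radMon d v : F m K) ∈ pow m K (d.degree + 1) := by
  induction d using multiIndex_induction with
  | zero => rw [radMon_zero]; simpa using v.2
  | add_single d j ih =>
    rw [radMon_add_single, map_add, Finsupp.degree_single]
    exact lie_mem_pow_succ ih _

/-- The commutator `[y_i, y_j]` as an element of `F_m'`. -/
def genLie (i j : Fin m) : pow m K 1 := ⟨⁅gen m K i, gen m K j⁆, lie_mem_pow_one _ _⟩

theorem genLie_swap (i j : Fin m) : genLie (K := K) i j = -genLie j i :=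
  Subtype.ext (lie_skew (gen m K i) (gen m K j)).symm

theorem radGen_genLie (i j k : Fin m) :
    radGen j (genLie i k) - radGen i (genLie j k) = radGen k (genLie (K := K) i j) := by
  refine Subtype.ext ?_
  change ⁅⁅gen m K i, gen m K k⁆, gen m K j⁆ - ⁅⁅gen m K j, gen m K k⁆, gen m K i⁆
    = ⁅⁅gen m K i, gen m K j⁆, gen m K k⁆
  generalize gen m K i = a
  generalize gen m K j = b
  generalize gen m K k = c
  have h := lie_jacobi a b c
  rw [← lie_skew ⁅a, c⁆ b, ← lie_skew ⁅b, c⁆ a, ← lie_skew ⁅a, b⁆ c, ← lie_skew c a, lie_neg] at *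
  rw [sub_eq_add_neg, neg_neg]
  rw [eq_neg_iff_add_eq_zero, ← h]
  abel

/-- The commutator ideal is spanned by the elements `t^d [y_i, y_j]`. -/
theorem span_radMon_genLie :
    Submodule.span K {w : pow m K 1 | ∃ d i j, w = radMon d (genLie i j)} = ⊤ := by
  set S := Submodule.span K {w : pow m K 1 | ∃ d i j, w = radMon d (genLie i j)} with hS
  have hrad : ∀ j, ∀ w ∈ S, radGen j w ∈ S := by
    intro j w hw
    induction hw using Submodule.span_induction with
    | mem x h =>
      obtain ⟨d, i, k, rfl⟩ := h
      exact Submodule.subset_span ⟨d + Finsupp.single j 1, i, k, (radMon_add_single d j _).symm⟩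
    | zero => rw [map_zero]; exact zero_mem _
    | add x y _ _ hx hy => rw [map_add]; exact add_mem hx hy
    | smul c x _ hx => rw [map_smul]; exact Submodule.smul_mem _ c hx
  let S' : Submodule K (F m K) := S.map (pow m K 1).toSubmodule.subtype
  have hS'1 : ∀ w ∈ S', w ∈ pow m K 1 := by
    rintro w ⟨x, -, rfl⟩; exact x.2
  have hS'g : ∀ j, ∀ w ∈ S', ⁅w, gen m K j⁆ ∈ S' := by
    rintro j w ⟨x, hx, rfl⟩
    exact ⟨_, hrad j x hx, rfl⟩
  have hgg : ∀ i j, ⁅gen m K i, gen m K j⁆ ∈ S' := fun i j =>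
    ⟨genLie i j, Submodule.subset_span ⟨0, i, j, by rw [radMon_zero]; rfl⟩, rfl⟩
  let G : Submodule K (F m K) := Submodule.span K (Set.range (gen m K))
  have hGG : ∀ a ∈ G, ∀ b ∈ G, ⁅a, b⁆ ∈ S' := by
    intro a ha b hb
    induction ha using Submodule.span_induction with
    | mem x h =>
      obtain ⟨i, rfl⟩ := h
      induction hb using Submodule.span_induction with
      | mem x h => obtain ⟨j, rfl⟩ := h; exact hgg i j
      | zero => rw [lie_zero]; exact zero_mem _
      | add x y _ _ hx hy => rw [lie_add]; exact add_mem hx hy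
      | smul c x _ hx => rw [lie_smul]; exact Submodule.smul_mem _ c hx
    | zero => rw [zero_lie]; exact zero_mem _
    | add x y _ _ hx hy => rw [add_lie]; exact add_mem hx hy
    | smul c x _ hx => rw [smul_lie]; exact Submodule.smul_mem _ c hx
  have hSG : ∀ a ∈ S', ∀ b ∈ G, ⁅a, b⁆ ∈ S' := by
    intro a ha b hb
    induction hb using Submodule.span_induction with
    | mem x h => obtain ⟨j, rfl⟩ := h; exact hS'g j a ha
    | zero => rw [lie_zero]; exact zero_mem _
    | add x y _ _ hx hy => rw [lie_add]; exact add_mem hx hy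
    | smul c x _ hx => rw [lie_smul]; exact Submodule.smul_mem _ c hx
  have key : ∀ a ∈ G ⊔ S', ∀ b ∈ G ⊔ S', ⁅a, b⁆ ∈ S' := by
    intro a ha b hb
    obtain ⟨a₁, ha₁, a₂, ha₂, rfl⟩ := Submodule.mem_sup.mp ha
    obtain ⟨b₁, hb₁, b₂, hb₂, rfl⟩ := Submodule.mem_sup.mp hb
    rw [add_lie, lie_add, lie_add, lie_eq_zero_of_mem (hS'1 _ ha₂) (hS'1 _ hb₂), add_zero]
    refine add_mem (add_mem (hGG _ ha₁ _ hb₁) ?_) (hSG _ ha₂ _ hb₁)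
    rw [← lie_skew]
    exact neg_mem (hSG _ hb₂ _ ha₁)
  -- the generators and the span `S'` together form a Lie subalgebra, hence everything
  let A : LieSubalgebra K (F m K) :=
    { G ⊔ S' with lie_mem' := fun {a b} ha hb => Submodule.mem_sup_right (key a ha b hb) }
  have hA : ∀ v, v ∈ G ⊔ S' := fun v => lieSubalgebra_eq_top A
    (fun i => Submodule.mem_sup_left (Submodule.subset_span ⟨i, rfl⟩)) v
  rw [eq_top_iff]
  rintro ⟨v, hv⟩ -
  have : v ∈ S' := pow_one_induction (p := fun v => v ∈ S') (fun a b => key a (hA a) b (hA b))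
    (zero_mem _) (fun _ _ => add_mem) (fun c _ => Submodule.smul_mem _ c) hv
  obtain ⟨x, hx, rfl⟩ := this
  exact hx

/-- Modulo `F_m'` every element is a linear combination of the generators. -/
theorem exists_gen_add (v : F m K) :
    ∃ β : Fin m → K, ∃ c ∈ pow m K 1, v = ∑ i, β i • gen m K i + c := by
  let G : Submodule K (F m K) := Submodule.span K (Set.range (gen m K))
  let A : LieSubalgebra K (F m K) :=
    { G ⊔ (pow m K 1).toSubmodule with
      lie_mem' := fun {a b} _ _ => Submodule.mem_sup_right (lie_mem_pow_one a b) }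
  have hA : v ∈ G ⊔ (pow m K 1).toSubmodule := lieSubalgebra_eq_top A
    (fun i => Submodule.mem_sup_left (Submodule.subset_span ⟨i, rfl⟩)) v
  obtain ⟨g, hg, c, hc, rfl⟩ := Submodule.mem_sup.mp hA
  obtain ⟨β, rfl⟩ := (Submodule.mem_span_range_iff_exists_fun K).mp hg
  exact ⟨β, c, hc, rfl⟩

/-! ### The embedding into the wreath product -/

theorem eps_b_of_mem {v : F m K} (hv : v ∈ pow m K 1) : (eps m K v).b = 0 :=
  (pderivCoeff_pow m K 1 v hv).1 one_ne_zero

theorem eps_radGen (j : Fin m) (v : pow m K 1) (i : Fin m) :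
    (eps m K (radGen j v : F m K)).a i = (eps m K (v : F m K)).a i * MvPolynomial.X j := by
  rw [coe_radGen, eps_lie, Wreath.lie_a, eps_b_of_mem v.2, Wreath.lin_zero, mul_zero, sub_zero,
    eps_gen]
  congr 1
  simp [Wreath.lin, Pi.single_apply]

theorem eps_radMon (d : Fin m →₀ ℕ) (v : pow m K 1) (i : Fin m) :
    (eps m K (radMon d v : F m K)).a i =
      (eps m K (v : F m K)).a i * MvPolynomial.monomial d 1 := by
  induction d using multiIndex_induction with
  | zero => rw [radMon_zero]; simp
  | add_single d j ih =>
    rw [radMon_add_single, eps_radGen, ih, mul_assoc, MvPolynomial.X, MvPolynomial.monomial_mul,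
      one_mul]

theorem eps_genLie (i j l : Fin m) :
    (eps m K (genLie (K := K) i j : F m K)).a l =
      (if l = i then MvPolynomial.X j else 0) - (if l = j then MvPolynomial.X i else 0) := by
  change (eps m K (⁅gen m K i, gen m K j⁆)).a l = _
  rw [eps_lie, Wreath.lie_a, eps_gen, eps_gen]
  simp [Wreath.lin, Pi.single_apply]

end algebra

/-! ### The contracting homotopy -/

section homotopy

variable {m : ℕ} {K : Type*} [Field K]

theorem constantCoeff_lin (β : Fin m → K) : MvPolynomial.constantCoeff (Wreath.lin β) = 0 := by
  simp [Wreath.lin, MvPolynomial.smul_eq_C_mul]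

theorem lin_single (j : Fin m) : Wreath.lin (Pi.single j (1 : K)) = MvPolynomial.X j := by
  simp [Wreath.lin, Pi.single_apply]

/-- The image of `F_m` in the wreath product satisfies `∑ t_i ∂v/∂y_i = ∑ β_i t_i`, where `β_i` is
the constant term of `∂v/∂y_i`. -/
theorem eps_relation (v : F m K) :
    ∑ i, MvPolynomial.X i * (eps m K v).a i = Wreath.lin (eps m K v).b ∧
      ∀ i, MvPolynomial.constantCoeff ((eps m K v).a i) = (eps m K v).b i := by
  let A : LieSubalgebra K (F m K) :=
    { carrier := {v | ∑ i, MvPolynomial.X i * (eps m K v).a i = Wreath.lin (eps m K v).b ∧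
        ∀ i, MvPolynomial.constantCoeff ((eps m K v).a i) = (eps m K v).b i}
      zero_mem' := by
        rw [Set.mem_ofPred_eq, map_zero]
        simp [Wreath.zero_a, Wreath.zero_b, Wreath.lin_zero]
      add_mem' := by
        rintro v w ⟨hv, hv'⟩ ⟨hw, hw'⟩
        rw [Set.mem_ofPred_eq, map_add]
        refine ⟨?_, fun i => ?_⟩
        · simp only [Wreath.add_a, Wreath.add_b, Wreath.lin_add, Pi.add_apply, mul_add,
            Finset.sum_add_distrib, hv, hw]
        · simp only [Wreath.add_a, Wreath.add_b, Pi.add_apply, map_add, hv', hw']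
      smul_mem' := by
        rintro c v ⟨hv, hv'⟩
        rw [Set.mem_ofPred_eq, map_smul]
        refine ⟨?_, fun i => ?_⟩
        · simp only [Wreath.smul_a, Wreath.smul_b, Wreath.lin_smul, Pi.smul_apply, mul_smul_comm,
            ← Finset.smul_sum, hv]
        · simp only [Wreath.smul_a, Wreath.smul_b, Pi.smul_apply, MvPolynomial.smul_eq_C_mul,
            map_mul, hv', MvPolynomial.constantCoeff_C, smul_eq_mul]
      lie_mem' := by
        rintro v w ⟨hv, -⟩ ⟨hw, -⟩
        rw [Set.mem_ofPred_eq, eps_lie]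
        refine ⟨?_, fun i => ?_⟩
        · simp only [Wreath.lie_a, Wreath.lie_b, Wreath.lin_zero, mul_sub, Finset.sum_sub_distrib,
            ← mul_assoc, ← Finset.sum_mul, hv, hw]
          ring
        · simp [Wreath.lie_a, Wreath.lie_b, constantCoeff_lin] }
  refine lieSubalgebra_eq_top A (fun j => ?_) v
  change _ ∧ _
  rw [eps_gen]
  refine ⟨?_, fun i => ?_⟩
  · simp [lin_single, Pi.single_apply]
  · by_cases h : i = j
    · subst h; simp
    · simp [h]

/-- The value `∑ k, d_k / (|d| + 1) • t^{d - e_k} [y_i, y_k]` of the contracting homotopy at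
`a_i t^d`. -/
def homotopyMon (i : Fin m) (d : Fin m →₀ ℕ) : pow m K 1 :=
  ∑ k, ((d k : K) / (d.degree + 1)) • radMon (d - Finsupp.single k 1) (genLie i k)

/-- The restriction of the contracting homotopy to the summand `a_i K[t_1, …, t_m]`. -/
def homotopyAux (i : Fin m) : MvPolynomial (Fin m) K →ₗ[K] pow m K 1 :=
  (MvPolynomial.basisMonomials (Fin m) K).constr K (homotopyMon i)

theorem homotopyAux_monomial (i : Fin m) (d : Fin m →₀ ℕ) (c : K) :
    homotopyAux i (MvPolynomial.monomial d c) = c • homotopyMon i d := by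
  have h : MvPolynomial.monomial d c = c • MvPolynomial.basisMonomials (Fin m) K d := by
    simp [MvPolynomial.smul_monomial]
  rw [h, map_smul, homotopyAux, Module.Basis.constr_basis]

/-- The contracting homotopy `⨁ a_i K[t_1, …, t_m] → F_m'` of the Koszul complex, given by Euler's
identity: it is a left inverse of the embedding of `F_m'` into the wreath product. -/
def homotopy (f : Fin m → MvPolynomial (Fin m) K) : pow m K 1 := ∑ i, homotopyAux i (f i)

theorem homotopy_add (f g : Fin m → MvPolynomial (Fin m) K) :
    homotopy (f + g) = homotopy f + homotopy g := by
  simp [homotopy, Finset.sum_add_distrib]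

theorem homotopy_smul (c : K) (f : Fin m → MvPolynomial (Fin m) K) :
    homotopy (c • f) = c • homotopy f := by
  simp [homotopy, Finset.smul_sum]

theorem sub_single_add_single {d : Fin m →₀ ℕ} {k : Fin m} (h : d k ≠ 0) :
    d - Finsupp.single k 1 + Finsupp.single k 1 = d :=
  tsub_add_cancel_of_le (Finsupp.single_le_iff.mpr (Nat.one_le_iff_ne_zero.mpr h))

theorem smul_radMon_add_sub (d : Fin m →₀ ℕ) (j k : Fin m) (w : pow m K 1) :
    (((d + Finsupp.single j 1 : Fin m →₀ ℕ) k : ℕ) : K) •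
        radMon (d + Finsupp.single j 1 - Finsupp.single k 1) w
      = (d k : K) • radGen j (radMon (d - Finsupp.single k 1) w)
        + if k = j then radMon d w else 0 := by
  by_cases hk : d k = 0
  · by_cases hkj : k = j
    · subst hkj
      simp [hk]
    · simp [hk, hkj]
  · have h1 : d + Finsupp.single j 1 - Finsupp.single k 1
        = d - Finsupp.single k 1 + Finsupp.single j 1 := by
      conv_lhs => rw [← sub_single_add_single hk, add_right_comm, add_tsub_cancel_right]
    rw [h1, radMon_add_single]
    by_cases hkj : k = j
    · subst hkj
      rw [← radMon_add_single, sub_single_add_single hk]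
      simp [add_smul]
    · simp [hkj]

theorem radMon_radGen (d : Fin m →₀ ℕ) (j : Fin m) (w : pow m K 1) :
    radMon d (radGen j w) = radGen j (radMon d w) := by
  rw [← radMon_add_single, radMon_add, radMon_single]; rfl

theorem degree_add_one_ne_zero [CharZero K] (d : Fin m →₀ ℕ) : ((d.degree : K) + 1) ≠ 0 := by
  exact_mod_cast Nat.succ_ne_zero d.degree

theorem homotopyMon_add_single [CharZero K] (i j : Fin m) (d : Fin m →₀ ℕ) :
    homotopyMon i (d + Finsupp.single j 1) - homotopyMon j (d + Finsupp.single i 1)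
      = radMon d (genLie (K := K) i j) := by
  have hd : ((d.degree + 1 : K) + 1) ≠ 0 := by exact_mod_cast Nat.succ_ne_zero (d.degree + 1)
  -- the Jacobi identity turns the difference of the two sums into `∑ d_k t^d [y_i, y_j]`; the terms
  -- with `k = j` and `k = i` account for the missing `2` in `|d| + 2`
  have hexp : ∀ i j : Fin m, ((d.degree + 1 : K) + 1) • homotopyMon i (d + Finsupp.single j 1)
      = ∑ k, (d k : K) • radMon (d - Finsupp.single k 1) (radGen j (genLie (K := K) i k))
        + radMon d (genLie i j) := by
    intro i j
    rw [homotopyMon, Finset.smul_sum]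
    have : ∀ k, ((d.degree + 1 : K) + 1) • ((((d + Finsupp.single j 1 : Fin m →₀ ℕ) k : ℕ) : K) /
        (((d + Finsupp.single j 1).degree : ℕ) + 1)) •
          radMon (d + Finsupp.single j 1 - Finsupp.single k 1) (genLie (K := K) i k)
        = (d k : K) • radMon (d - Finsupp.single k 1) (radGen j (genLie (K := K) i k))
          + if k = j then radMon d (genLie i k) else 0 := by
      intro k
      rw [radMon_radGen, ← smul_radMon_add_sub, smul_smul, map_add, Finsupp.degree_single]
      push_cast
      rw [mul_div_cancel₀ _ hd]
    rw [Finset.sum_congr rfl fun k _ => this k, Finset.sum_add_distrib]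
    simp
  have h2 : ((d.degree + 1 : K) + 1) • (homotopyMon i (d + Finsupp.single j 1)
      - homotopyMon j (d + Finsupp.single i 1))
      = ((d.degree + 1 : K) + 1) • radMon d (genLie (K := K) i j) := by
    rw [smul_sub, hexp, hexp, add_sub_add_comm, ← Finset.sum_sub_distrib]
    have : ∀ k, (d k : K) • radMon (d - Finsupp.single k 1) (radGen j (genLie (K := K) i k))
        - (d k : K) • radMon (d - Finsupp.single k 1) (radGen i (genLie (K := K) j k))
        = (d k : K) • radMon d (genLie i j) := by
      intro k
      rw [← smul_sub, ← map_sub, radGen_genLie]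
      by_cases hk : d k = 0
      · simp [hk]
      · rw [radMon_radGen, ← radMon_add_single, sub_single_add_single hk]
    rw [Finset.sum_congr rfl fun k _ => this k, ← Finset.sum_smul, genLie_swap j i, map_neg,
      sub_neg_eq_add, add_assoc, add_smul, add_smul, one_smul, Finsupp.degree_eq_sum]
    push_cast
    rfl
  exact smul_right_injective _ hd h2

/-- The homotopy inverts the embedding on the commutator ideal. -/
theorem homotopy_eps [CharZero K] (v : pow m K 1) : homotopy (eps m K (v : F m K)).a = v := by
  have hv : v ∈ Submodule.span K {w : pow m K 1 | ∃ d i j, w = radMon d (genLie i j)} := by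
    rw [span_radMon_genLie]; trivial
  induction hv using Submodule.span_induction with
  | mem x h =>
    obtain ⟨d, i, j, rfl⟩ := h
    rw [homotopy]
    have h1 : ∀ l, homotopyAux l ((eps m K (radMon d (genLie (K := K) i j) : F m K)).a l)
        = (if l = i then homotopyMon i (d + Finsupp.single j 1) else 0)
          - if l = j then homotopyMon j (d + Finsupp.single i 1) else 0 := by
      intro l
      have hX : ∀ j : Fin m, MvPolynomial.X j * MvPolynomial.monomial d (1 : K)
          = MvPolynomial.monomial (d + Finsupp.single j 1) 1 := fun j => by
        rw [MvPolynomial.X, MvPolynomial.monomial_mul, one_mul, add_comm]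
      rw [eps_radMon, eps_genLie, sub_mul, map_sub]
      congr 1
      · by_cases h : l = i
        · subst h; simp [hX, homotopyAux_monomial]
        · simp [h]
      · by_cases h : l = j
        · subst h; simp [hX, homotopyAux_monomial]
        · simp [h]
    rw [Finset.sum_congr rfl fun l _ => h1 l, Finset.sum_sub_distrib]
    simp [homotopyMon_add_single]
  | zero =>
    rw [LieSubmodule.coe_zero, map_zero]
    simp [Wreath.zero_a, homotopy]
  | add x y _ _ hx hy => rw [LieSubmodule.coe_add, map_add, Wreath.add_a, homotopy_add, hx, hy]
  | smul c x _ hx => rw [LieSubmodule.coe_smul, map_smul, Wreath.smul_a, homotopy_smul, hx]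

variable (K) in
/-- The operator `t^d ↦ t^d / (|d| + 1)`. -/
def eulerScale : MvPolynomial (Fin m) K →ₗ[K] MvPolynomial (Fin m) K :=
  (MvPolynomial.basisMonomials (Fin m) K).constr K
    fun d => MvPolynomial.monomial d ((d.degree + 1 : K)⁻¹)

theorem eulerScale_monomial (d : Fin m →₀ ℕ) (c : K) :
    eulerScale K (MvPolynomial.monomial d c) = MvPolynomial.monomial d (c / (d.degree + 1)) := by
  have h : MvPolynomial.monomial d c = c • MvPolynomial.basisMonomials (Fin m) K d := by
    simp [MvPolynomial.smul_monomial]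
  rw [h, map_smul, eulerScale, Module.Basis.constr_basis, MvPolynomial.smul_monomial,
    div_eq_mul_inv, smul_eq_mul]

/-- The partial derivative `∂/∂y_l` on the commutator ideal, as a linear map. -/
def epsCoord (l : Fin m) : pow m K 1 →ₗ[K] MvPolynomial (Fin m) K where
  toFun v := (eps m K (v : F m K)).a l
  map_add' v w := by rw [LieSubmodule.coe_add, map_add, Wreath.add_a]; rfl
  map_smul' c v := by rw [LieSubmodule.coe_smul, map_smul, Wreath.smul_a]; rfl

theorem epsCoord_homotopyMon [CharZero K] (i l : Fin m) (d : Fin m →₀ ℕ) :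
    epsCoord l (homotopyMon (K := K) i d)
      = (if l = i then MvPolynomial.monomial d 1 else 0)
        - eulerScale K (MvPolynomial.pderiv l (MvPolynomial.X i * MvPolynomial.monomial d 1)) := by
  have hd := degree_add_one_ne_zero (K := K) d
  have h1 : ∀ k, ((d k : K) / (d.degree + 1)) • epsCoord l
        (radMon (d - Finsupp.single k 1) (genLie i k))
      = (if l = i then MvPolynomial.monomial d ((d k : K) / (d.degree + 1)) else 0)
        - if l = k then eulerScale K (MvPolynomial.X i * MvPolynomial.pderiv l
            (MvPolynomial.monomial d 1)) else 0 := by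
    intro k
    change _ • (eps m K (radMon (d - Finsupp.single k 1) (genLie (K := K) i k) : F m K)).a l = _
    rw [eps_radMon, eps_genLie, sub_mul, smul_sub]
    congr 1
    · by_cases hl : l = i
      · by_cases hk : d k = 0
        · simp [hl, hk]
        · rw [if_pos hl, if_pos hl, MvPolynomial.X, MvPolynomial.monomial_mul, one_mul,
            MvPolynomial.smul_monomial, add_comm, sub_single_add_single hk, smul_eq_mul, mul_one]
      · simp [hl]
    · by_cases hl : l = k
      · subst hl
        rw [if_pos rfl, if_pos rfl, MvPolynomial.pderiv_monomial, MvPolynomial.X,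
          MvPolynomial.monomial_mul, MvPolynomial.monomial_mul, eulerScale_monomial,
          MvPolynomial.smul_monomial]
        by_cases hk : d l = 0
        · simp [hk]
        · have h2 : (Finsupp.single i 1 + (d - Finsupp.single l 1)).degree = d.degree := by
            have h3 := congrArg Finsupp.degree (sub_single_add_single hk)
            rw [map_add, Finsupp.degree_single] at h3 ⊢
            omega
          rw [h2]
          simp
      · simp [hl]
  rw [homotopyMon, map_sum]
  simp only [map_smul]
  rw [Finset.sum_congr rfl fun k _ => h1 k, Finset.sum_sub_distrib, Finset.sum_ite_eq,
    if_pos (Finset.mem_univ _), Derivation.leibniz, MvPolynomial.pderiv_X, smul_eq_mul,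
    smul_eq_mul, map_add, sub_add_eq_sub_sub_swap]
  congr 1
  by_cases hl : l = i
  · subst hl
    simp only [if_pos, Pi.single_eq_same, mul_one, eulerScale_monomial]
    rw [← map_sum, eq_sub_iff_add_eq, ← map_add, ← Finset.sum_div, ← Nat.cast_sum,
      ← Finsupp.degree_eq_sum, ← add_div, div_self hd]
  · simp [hl, Ne.symm hl]

theorem epsCoord_homotopyAux [CharZero K] (i l : Fin m) (p : MvPolynomial (Fin m) K) :
    epsCoord l (homotopyAux i p)
      = (if l = i then p else 0)
        - eulerScale K (MvPolynomial.pderiv l (MvPolynomial.X i * p)) := by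
  induction p using MvPolynomial.induction_on' with
  | monomial d c =>
    have h : MvPolynomial.monomial d c = c • MvPolynomial.monomial d (1 : K) := by
      simp [MvPolynomial.smul_monomial]
    rw [homotopyAux_monomial, h, map_smul, epsCoord_homotopyMon, mul_smul_comm, Derivation.map_smul,
      map_smul, smul_sub]
    simp
  | add p q hp hq =>
    rw [map_add, map_add, hp, hq, mul_add, map_add, map_add]
    split_ifs <;> ring

/-- The homotopy is also a right inverse of the embedding on the syzygies of `t_1, …, t_m`. -/
theorem eps_homotopy [CharZero K] (f : Fin m → MvPolynomial (Fin m) K)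
    (hf : ∑ i, MvPolynomial.X i * f i = 0) :
    (eps m K (homotopy f : F m K)).a = f := by
  funext l
  change epsCoord l (homotopy f) = f l
  rw [homotopy, map_sum]
  simp only [epsCoord_homotopyAux]
  rw [Finset.sum_sub_distrib, ← map_sum, ← map_sum, hf]
  simp

theorem homotopyMon_mem (i : Fin m) (d : Fin m →₀ ℕ) :
    (homotopyMon (K := K) i d : F m K) ∈ pow m K d.degree := by
  have : homotopyMon (K := K) i d ∈
      (pow m K d.degree).toSubmodule.comap (pow m K 1).toSubmodule.subtype := by
    refine sum_mem fun k _ => ?_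
    by_cases hk : d k = 0
    · simp [hk]
    · refine Submodule.smul_mem _ _ ?_
      have h := coe_radMon_mem (d - Finsupp.single k 1) (genLie (K := K) i k)
      have h3 := congrArg Finsupp.degree (sub_single_add_single hk)
      rw [map_add, Finsupp.degree_single] at h3
      rw [h3] at h
      exact h
  exact this

theorem homotopy_mem {f : Fin m → MvPolynomial (Fin m) K} {k : ℕ}
    (hf : ∀ i (d : Fin m →₀ ℕ), d.degree < k → (f i).coeff d = 0) :
    (homotopy f : F m K) ∈ pow m K k := by
  have : homotopy f ∈ (pow m K k).toSubmodule.comap (pow m K 1).toSubmodule.subtype := by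
    refine sum_mem fun i _ => ?_
    rw [(f i).as_sum, map_sum]
    refine sum_mem fun d hd => ?_
    rw [homotopyAux_monomial]
    refine Submodule.smul_mem _ _ ?_
    refine LieModule.antitone_lowerCentralSeries K (F m K) (F m K) (?_ : k ≤ d.degree)
      (homotopyMon_mem i d)
    by_contra! h
    exact MvPolynomial.mem_support_iff.mp hd (hf i d h)
  exact this

/-- The embedding is strict for the filtrations by powers and by degree. -/
theorem mem_pow_of_pderivCoeff_eq_zero [CharZero K] {v : F m K} {k : ℕ}
    (hv : ∀ i (d : Fin m →₀ ℕ), d.degree < k → pderivCoeff m K i d v = 0) : v ∈ pow m K k := by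
  rcases Nat.eq_zero_or_pos k with rfl | hk
  · simp
  have hmem : v ∈ pow m K 1 := by
    obtain ⟨β, c, hc, rfl⟩ := exists_gen_add v
    have hβ : β = 0 := by
      funext i
      have h1 := hv i 0 (by simpa using hk)
      have h2 := (eps_relation (∑ i, β i • gen m K i + c)).2 i
      rw [MvPolynomial.constantCoeff_eq] at h2
      have h3 : (eps m K (∑ i, β i • gen m K i + c)).b i = 0 := h2.symm.trans h1
      have h4 : ∀ s : Finset (Fin m), (eps m K (∑ i ∈ s, β i • gen m K i)).b
          = ∑ j ∈ s, β j • Pi.single j 1 := by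
        intro s
        induction s using Finset.induction_on with
        | empty => simp [Wreath.zero_b]
        | insert a s ha ih =>
          rw [Finset.sum_insert ha, Finset.sum_insert ha, map_add, Wreath.add_b, ih, map_smul,
            Wreath.smul_b, eps_gen]
      rw [map_add, Wreath.add_b, eps_b_of_mem hc, h4] at h3
      simpa [Pi.single_apply] using h3
    subst hβ
    simpa using hc
  have h := homotopy_eps ⟨v, hmem⟩
  have h2 := homotopy_mem (f := (eps m K v).a) hv
  rw [h] at h2
  exact h2

end homotopy

/-! ### Gradients of elements of the completion -/

section series

variable {m : ℕ} {K : Type*} [Field K]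

/-- Congruence of power series modulo terms of total degree at least `k`. -/
def AgreeBelow (k : ℕ) (f g : MvPowerSeries (Fin m) K) : Prop :=
  ∀ d : Fin m →₀ ℕ, d.degree < k → MvPowerSeries.coeff d f = MvPowerSeries.coeff d g

namespace AgreeBelow

variable {k : ℕ} {f f' g g' : MvPowerSeries (Fin m) K}

theorem refl (k : ℕ) (f : MvPowerSeries (Fin m) K) : AgreeBelow k f f := fun _ _ => rfl

theorem symm (h : AgreeBelow k f g) : AgreeBelow k g f := fun d hd => (h d hd).symm

theorem trans {h : MvPowerSeries (Fin m) K} (h₁ : AgreeBelow k f g) (h₂ : AgreeBelow k g h) :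
    AgreeBelow k f h := fun d hd => (h₁ d hd).trans (h₂ d hd)

theorem mono {l : ℕ} (h : AgreeBelow k f g) (hl : l ≤ k) : AgreeBelow l f g :=
  fun d hd => h d (hd.trans_le hl)

theorem add (h : AgreeBelow k f f') (h' : AgreeBelow k g g') : AgreeBelow k (f + g) (f' + g') :=
  fun d hd => by rw [map_add, map_add, h d hd, h' d hd]

theorem sub (h : AgreeBelow k f f') (h' : AgreeBelow k g g') : AgreeBelow k (f - g) (f' - g') :=
  fun d hd => by rw [map_sub, map_sub, h d hd, h' d hd]

theorem mul (h : AgreeBelow k f f') (h' : AgreeBelow k g g') : AgreeBelow k (f * g) (f' * g') := by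
  intro d hd
  rw [MvPowerSeries.coeff_mul, MvPowerSeries.coeff_mul]
  refine Finset.sum_congr rfl fun p hp => ?_
  have h1 := congrArg Finsupp.degree (Finset.HasAntidiagonal.mem_antidiagonal.mp hp)
  rw [map_add] at h1
  rw [h p.1 (by omega), h' p.2 (by omega)]

theorem sum {ι : Type*} {s : Finset ι} {F G : ι → MvPowerSeries (Fin m) K}
    (h : ∀ i ∈ s, AgreeBelow k (F i) (G i)) : AgreeBelow k (∑ i ∈ s, F i) (∑ i ∈ s, G i) :=
  fun d hd => by
    rw [map_sum, map_sum]
    exact Finset.sum_congr rfl fun i hi => h i hi d hd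

theorem ext (h : ∀ k, AgreeBelow k f g) : f = g :=
  MvPowerSeries.ext fun d => h (d.degree + 1) d (Nat.lt_succ_self _)

theorem constantCoeff_eq (h : AgreeBelow k f g) (hk : 0 < k) :
    MvPowerSeries.constantCoeff f = MvPowerSeries.constantCoeff g := by
  have := h 0 (by simpa using hk)
  simpa using this

end AgreeBelow

theorem coeff_X_mul_eq_ite (j : Fin m) (f : MvPowerSeries (Fin m) K) (d : Fin m →₀ ℕ) :
    MvPowerSeries.coeff d (MvPowerSeries.X j * f)
      = if d j = 0 then 0 else MvPowerSeries.coeff (d - Finsupp.single j 1) f := by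
  classical
  rw [MvPowerSeries.X, MvPowerSeries.coeff_monomial_mul, one_mul]
  by_cases h : d j = 0
  · simp [h]
  · rw [if_pos (Finsupp.single_le_iff.mpr (Nat.one_le_iff_ne_zero.mpr h)), if_neg h]

/-- The linear form `∑ f_i(0) t_i` attached to a vector of power series. -/
def linPart (f : Fin m → MvPowerSeries (Fin m) K) : MvPowerSeries (Fin m) K :=
  ((Wreath.lin fun i => MvPowerSeries.constantCoeff (f i) : MvPolynomial (Fin m) K) :
    MvPowerSeries (Fin m) K)

theorem linPart_congr {f g : Fin m → MvPowerSeries (Fin m) K}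
    (h : ∀ i, MvPowerSeries.constantCoeff (f i) = MvPowerSeries.constantCoeff (g i)) :
    linPart f = linPart g := by
  rw [linPart, linPart, funext h]

theorem linPart_eq_sum (f : Fin m → MvPowerSeries (Fin m) K) :
    linPart f = ∑ i, MvPowerSeries.X i * MvPowerSeries.C (MvPowerSeries.constantCoeff (f i)) := by
  rw [linPart, Wreath.lin, ← MvPolynomial.coeToMvPowerSeries.ringHom_apply, map_sum]
  refine Finset.sum_congr rfl fun i _ => ?_
  rw [MvPolynomial.smul_eq_C_mul, map_mul]
  simp [mul_comm]

end series

section completion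

variable {m : ℕ} {K : Type*} [Field K]

/-- The coefficient of `t^d` in the partial derivative `∂/∂y_i`, on `F_m / F_m^{|d| + 2}`. -/
def pderivCoeffQuot (i : Fin m) (d : Fin m →₀ ℕ) :
    (F m K ⧸ pow m K (d.degree + 1)) →ₗ[K] K :=
  Submodule.liftQ (pow m K (d.degree + 1)).toSubmodule (pderivCoeff m K i d)
    fun f hf => (pderivCoeff_pow m K (d.degree + 1) f hf).2 i d (Nat.lt_succ_self _)

/-- The vector `(∂x/∂y_1, …, ∂x/∂y_m)` of the partial derivatives. -/
def grad : Fhat m K →ₗ[K] Fin m → MvPowerSeries (Fin m) K where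
  toFun x i := pderiv m K i x
  map_add' x y := by
    funext i
    refine MvPowerSeries.ext fun d => ?_
    rw [Pi.add_apply, map_add]
    exact map_add (pderivCoeffQuot i d)
      (proj m K (d.degree + 1) x) (proj m K (d.degree + 1) y)
  map_smul' c x := by
    funext i
    refine MvPowerSeries.ext fun d => ?_
    rw [Pi.smul_apply, map_smul]
    exact map_smul (pderivCoeffQuot i d)
      c (proj m K (d.degree + 1) x)

theorem coeff_grad (x : Fhat m K) (i : Fin m) (d : Fin m →₀ ℕ) (v : F m K)
    (h : proj m K (d.degree + 1) x = LieSubmodule.Quotient.mk v) :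
    MvPowerSeries.coeff d (grad x i) = ((eps m K v).a i).coeff d := by
  change pderivCoeffQuot i d (proj m K (d.degree + 1) x) = _
  rw [h]
  rfl

/-- Every element of the completion is approximated by elements of `F_m`. -/
theorem exists_approx (x : Fhat m K) (k : ℕ) : ∃ v : F m K,
    (∀ l ≤ k, proj m K l x = LieSubmodule.Quotient.mk v) ∧
      ∀ i, AgreeBelow k (grad x i) ((eps m K v).a i : MvPolynomial (Fin m) K) := by
  obtain ⟨v, hv⟩ := x.2 k
  refine ⟨v, hv, fun i d hd => ?_⟩
  rw [coeff_grad x i d v (hv _ hd), MvPolynomial.coeff_coe]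

theorem grad_toHat (v : F m K) (i : Fin m) :
    grad (toHat m K v) i = ((eps m K v).a i : MvPolynomial (Fin m) K) :=
  MvPowerSeries.ext fun d => by rw [coeff_grad _ i d v rfl, MvPolynomial.coeff_coe]

theorem grad_gen (j : Fin m) : grad (toHat m K (gen m K j)) = Pi.single j 1 := by
  funext i
  rw [grad_toHat, eps_gen]
  by_cases h : i = j
  · subst h; simp
  · simp [h]

theorem linPart_eq_of_agree {k : ℕ} (hk : 0 < k) {f : Fin m → MvPowerSeries (Fin m) K} {v : F m K}
    (h : ∀ i, AgreeBelow k (f i) ((eps m K v).a i : MvPolynomial (Fin m) K)) :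
    linPart f = (Wreath.lin (eps m K v).b : MvPolynomial (Fin m) K) := by
  rw [linPart]
  congr 2
  funext i
  rw [(h i).constantCoeff_eq hk, ← (eps_relation v).2 i,
    ← MvPowerSeries.coeff_zero_eq_constantCoeff_apply, MvPolynomial.coeff_coe,
    MvPolynomial.constantCoeff_eq]

/-- The gradients of elements of the completion are the vectors `f` of power series with
`∑ t_i (f_i - f_i(0)) = 0`. -/
theorem grad_relation (x : Fhat m K) :
    ∑ i, MvPowerSeries.X i * grad x i = linPart (grad x) := by
  refine AgreeBelow.ext fun k => ?_
  obtain ⟨v, -, hv⟩ := exists_approx x (k + 1)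
  rw [linPart_eq_of_agree k.succ_pos hv, ← (eps_relation v).1,
    ← MvPolynomial.coeToMvPowerSeries.ringHom_apply, map_sum]
  refine AgreeBelow.sum fun i _ => ?_
  rw [map_mul, MvPolynomial.coeToMvPowerSeries.ringHom_apply,
    MvPolynomial.coeToMvPowerSeries.ringHom_apply, MvPolynomial.coe_X]
  exact (AgreeBelow.refl _ _).mul ((hv i).mono k.le_succ)

theorem proj_lie (k : ℕ) (x y : Fhat m K) : proj m K k ⁅x, y⁆ = ⁅proj m K k x, proj m K k y⁆ := rfl

theorem grad_lie (x y : Fhat m K) (i : Fin m) :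
    grad ⁅x, y⁆ i = grad x i * linPart (grad y) - grad y i * linPart (grad x) := by
  refine AgreeBelow.ext fun k => ?_
  obtain ⟨v, hv', hv⟩ := exists_approx x (k + 1)
  obtain ⟨w, hw', hw⟩ := exists_approx y (k + 1)
  have h : AgreeBelow (k + 1) (grad ⁅x, y⁆ i)
      ((eps m K ⁅v, w⁆).a i : MvPolynomial (Fin m) K) := by
    intro d hd
    rw [MvPolynomial.coeff_coe]
    refine coeff_grad _ i d _ ?_
    rw [proj_lie, hv' _ hd, hw' _ hd]
    rfl
  refine (h.trans ?_).mono k.le_succ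
  rw [eps_lie, Wreath.lie_a, linPart_eq_of_agree k.succ_pos hv, linPart_eq_of_agree k.succ_pos hw,
    ← MvPolynomial.coeToMvPowerSeries.ringHom_apply, map_sub, map_mul, map_mul]
  simp only [MvPolynomial.coeToMvPowerSeries.ringHom_apply]
  exact (((hv i).symm.mul (AgreeBelow.refl _ _)).sub ((hw i).symm.mul (AgreeBelow.refl _ _)))

theorem proj_eq_zero_iff [CharZero K] (k : ℕ) (x : Fhat m K) :
    proj m K k x = 0 ↔ ∀ i, AgreeBelow k (grad x i) 0 := by
  obtain ⟨v, hv', hv⟩ := exists_approx x k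
  have h1 : proj m K k x = 0 ↔ v ∈ pow m K k := by
    rw [hv' k le_rfl]; exact LieSubmodule.Quotient.mk_eq_zero'
  rw [h1]
  constructor
  · intro h i d hd
    rw [hv i d hd, MvPolynomial.coeff_coe, map_zero]
    exact (pderivCoeff_pow m K k v h).2 i d hd
  · intro h
    refine mem_pow_of_pderivCoeff_eq_zero fun i d hd => ?_
    have h2 := hv i d hd
    rw [h i d hd, map_zero, MvPolynomial.coeff_coe] at h2
    exact h2.symm

theorem proj_eq_iff [CharZero K] (k : ℕ) (x y : Fhat m K) :
    proj m K k x = proj m K k y ↔ ∀ i, AgreeBelow k (grad x i) (grad y i) := by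
  have h1 : proj m K k x = proj m K k y ↔ proj m K k (x - y) = 0 := sub_eq_zero.symm
  rw [h1, proj_eq_zero_iff]
  refine forall_congr' fun i => forall_congr' fun d => forall_congr' fun _ => ?_
  rw [map_sub, Pi.sub_apply, map_sub, map_zero, sub_eq_zero]

theorem grad_injective [CharZero K] : Function.Injective (grad : Fhat m K → _) := by
  intro x y h
  refine Subtype.ext (funext fun k => ?_)
  exact (proj_eq_iff k x y).mpr fun i => by rw [h]; exact AgreeBelow.refl _ _

theorem exists_grad_eq_of_syzygy [CharZero K] (f : Fin m → MvPowerSeries (Fin m) K)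
    (hf : ∑ i, MvPowerSeries.X i * f i = 0) : ∃ x : Fhat m K, grad x = f := by
  -- the truncations of a syzygy are syzygies, and the homotopy lifts them to `F_m`
  let P : ℕ → Fin m → MvPolynomial (Fin m) K := fun k i => MvPowerSeries.truncTotal k (f i)
  have hP : ∀ k, ∑ i, MvPolynomial.X i * P k i = 0 := by
    intro k
    refine MvPolynomial.coe_injective (Fin m) K ?_
    refine MvPowerSeries.ext fun d => ?_
    rw [← MvPolynomial.coeToMvPowerSeries.ringHom_apply, map_sum, map_sum, MvPolynomial.coe_zero,
      map_zero]
    have h1 : ∀ i, MvPowerSeries.coeff d (MvPolynomial.coeToMvPowerSeries.ringHom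
        (MvPolynomial.X i * P k i)) = if d.degree < k + 1 then
          MvPowerSeries.coeff d (MvPowerSeries.X i * f i) else 0 := by
      intro i
      rw [map_mul, MvPolynomial.coeToMvPowerSeries.ringHom_apply,
        MvPolynomial.coeToMvPowerSeries.ringHom_apply, MvPolynomial.coe_X, coeff_X_mul_eq_ite,
        coeff_X_mul_eq_ite, MvPolynomial.coeff_coe, MvPowerSeries.coeff_truncTotal_eq_ite]
      by_cases hd : d i = 0
      · simp [hd]
      · have h3 := congrArg Finsupp.degree (sub_single_add_single hd)
        rw [map_add, Finsupp.degree_single] at h3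
        rw [if_neg hd, if_neg hd]
        refine if_congr ?_ rfl rfl
        omega
    rw [Finset.sum_congr rfl fun i _ => h1 i]
    split_ifs
    · rw [← map_sum, hf, map_zero]
    · exact Finset.sum_const_zero
  let v : ℕ → F m K := fun k => homotopy (P k)
  have hv : ∀ k, (eps m K (v k)).a = P k := fun k => eps_homotopy (P k) (hP k)
  refine ⟨⟨fun k => LieSubmodule.Quotient.mk (v k), fun k => ⟨v k, fun l hl => ?_⟩⟩, ?_⟩
  · rw [← sub_eq_zero]
    refine LieSubmodule.Quotient.mk_eq_zero'.mpr (mem_pow_of_pderivCoeff_eq_zero fun i d hd => ?_)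
    rw [map_sub, sub_eq_zero]
    change ((eps m K (v l)).a i).coeff d = ((eps m K (v k)).a i).coeff d
    rw [hv, hv, MvPowerSeries.coeff_truncTotal _ hd,
      MvPowerSeries.coeff_truncTotal _ (hd.trans_le hl)]
  · funext i
    refine MvPowerSeries.ext fun d => ?_
    rw [coeff_grad _ i d (v (d.degree + 1)) rfl, hv,
      MvPowerSeries.coeff_truncTotal _ (Nat.lt_succ_self _)]

theorem exists_grad_eq [CharZero K] (f : Fin m → MvPowerSeries (Fin m) K)
    (hf : ∑ i, MvPowerSeries.X i * f i = linPart f) : ∃ x : Fhat m K, grad x = f := by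
  let g : Fhat m K := ∑ j, MvPowerSeries.constantCoeff (f j) • toHat m K (gen m K j)
  have hg : ∀ i, grad g i = MvPowerSeries.C (MvPowerSeries.constantCoeff (f i)) := by
    intro i
    simp only [g, map_sum, map_smul, grad_gen, Finset.sum_apply, Pi.smul_apply, Pi.single_apply]
    simp [MvPowerSeries.smul_eq_C_mul]
  obtain ⟨x, hx⟩ := exists_grad_eq_of_syzygy (fun i => f i - grad g i) (by
    simp only [mul_sub, Finset.sum_sub_distrib, hf, hg, linPart_eq_sum, sub_self])
  refine ⟨x + g, ?_⟩
  rw [map_add, hx]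
  funext i
  simp

end completion

/-! ### Division by variables, the commutator ideal and the topology of the completion -/

section division

variable {m : ℕ} {K : Type*} [Field K]

open scoped Classical in
/-- The part of the power series `f` consisting of the monomials whose first variable is `t_l`,
divided by `t_l`. -/
def divMin (l : Fin m) (f : MvPowerSeries (Fin m) K) : MvPowerSeries (Fin m) K := fun d =>
  if ∀ j < l, d j = 0 then MvPowerSeries.coeff (d + Finsupp.single l 1) f else 0

open scoped Classical in
theorem coeff_divMin (l : Fin m) (f : MvPowerSeries (Fin m) K) (d : Fin m →₀ ℕ) :
    MvPowerSeries.coeff d (divMin l f)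
      = if ∀ j < l, d j = 0 then MvPowerSeries.coeff (d + Finsupp.single l 1) f else 0 := rfl

theorem exists_min_support {d : Fin m →₀ ℕ} (hd : d ≠ 0) : ∃ l, d l ≠ 0 ∧ ∀ j < l, d j = 0 := by
  have hs : d.support.Nonempty := Finsupp.support_nonempty_iff.mpr hd
  refine ⟨d.support.min' hs, Finsupp.mem_support_iff.mp (d.support.min'_mem hs), fun j hj => ?_⟩
  by_contra h
  exact absurd (d.support.min'_le j (Finsupp.mem_support_iff.mpr h)) (not_le.mpr hj)

theorem sub_single_apply_of_ne (d : Fin m →₀ ℕ) {j l : Fin m} (h : j ≠ l) :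
    (d - Finsupp.single l 1 : Fin m →₀ ℕ) j = d j := by
  simp [Ne.symm h]

/-- In `∑ t_i q_i` with `q_i ∈ K[[t_i, …, t_m]]`, the monomials whose first variable is `t_l` come
from the summand `t_l q_l` only. -/
theorem coeff_X_mul_of_first {q : Fin m → MvPowerSeries (Fin m) K}
    (hq : ∀ l, InVars {j | l ≤ j} (q l)) {d : Fin m →₀ ℕ} {l : Fin m} (hl : d l ≠ 0)
    (hmin : ∀ j < l, d j = 0) (i : Fin m) :
    MvPowerSeries.coeff d (MvPowerSeries.X i * q i)
      = if i = l then MvPowerSeries.coeff (d - Finsupp.single l 1 : Fin m →₀ ℕ) (q l) else 0 := by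
  rw [coeff_X_mul_eq_ite]
  rcases lt_trichotomy i l with h | h | h
  · rw [if_pos (hmin i h), if_neg h.ne]
  · subst h; rw [if_neg hl, if_pos rfl]
  · rw [if_neg h.ne']
    split_ifs
    · rfl
    · by_contra h2
      have := hq i _ h2 l (by rwa [sub_single_apply_of_ne d h.ne])
      exact absurd this (not_le.mpr h)

/-- The decomposition `∑ t_i q_i` with `q_i ∈ K[[t_i, …, t_m]]` is unique. -/
theorem coeff_eq_of_sum_X_mul {q : Fin m → MvPowerSeries (Fin m) K}
    (hq : ∀ l, InVars {j | l ≤ j} (q l)) {d : Fin m →₀ ℕ} {l : Fin m}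
    (hmin : ∀ j < l, d j = 0) :
    MvPowerSeries.coeff d (q l)
      = MvPowerSeries.coeff (d + Finsupp.single l 1) (∑ i, MvPowerSeries.X i * q i) := by
  rw [map_sum, Finset.sum_congr rfl fun i _ => coeff_X_mul_of_first hq (l := l) (by simp)
    (fun j hj => by simp [hmin j hj, hj.ne]) i]
  simp

theorem divMin_inVars (l : Fin m) (f : MvPowerSeries (Fin m) K) :
    InVars {j | l ≤ j} (divMin l f) := by
  intro d hd j hj
  rw [coeff_divMin] at hd
  by_contra h
  refine hj ?_
  split_ifs at hd with h2
  · exact h2 j (not_le.mp h)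
  · exact absurd rfl hd

theorem sum_X_mul_divMin (f : MvPowerSeries (Fin m) K) :
    ∑ l, MvPowerSeries.X l * divMin l f = f - MvPowerSeries.C (MvPowerSeries.constantCoeff f) := by
  classical
  refine MvPowerSeries.ext fun d => ?_
  by_cases hd : d = 0
  · subst hd
    simp [map_sum]
  · obtain ⟨l, hl, hmin⟩ := exists_min_support hd
    rw [map_sum, Finset.sum_congr rfl fun i _ =>
      coeff_X_mul_of_first (fun l => divMin_inVars l f) hl hmin i]
    rw [Finset.sum_ite_eq', if_pos (Finset.mem_univ _), coeff_divMin, if_pos, map_sub,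
      MvPowerSeries.coeff_C, if_neg hd, sub_zero, sub_single_add_single hl]
    intro j hj
    rw [sub_single_apply_of_ne d hj.ne, hmin j hj]

end division

section derived

variable {m : ℕ} {K : Type*} [Field K]

theorem constantCoeff_linPart (f : Fin m → MvPowerSeries (Fin m) K) :
    MvPowerSeries.constantCoeff (linPart f) = 0 := by
  simp [linPart_eq_sum, map_sum]

theorem linPart_eq_zero {f : Fin m → MvPowerSeries (Fin m) K}
    (h : ∀ i, MvPowerSeries.constantCoeff (f i) = 0) : linPart f = 0 := by
  simp [linPart_eq_sum, h]

theorem linPart_grad_gen (j : Fin m) :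
    linPart (grad (toHat m K (gen m K j))) = MvPowerSeries.X j := by
  rw [← grad_relation, grad_gen]
  simp [Pi.single_apply]

theorem lie_mem_derived (x y : Fhat m K) : ⁅x, y⁆ ∈ LieAlgebra.derivedSeries K (Fhat m K) 1 :=
  LieSubmodule.lie_mem_lie (LieSubmodule.mem_top x) (LieSubmodule.mem_top y)

theorem constantCoeff_grad_of_mem {x : Fhat m K}
    (hx : x ∈ LieAlgebra.derivedSeries K (Fhat m K) 1) (i : Fin m) :
    MvPowerSeries.constantCoeff (grad x i) = 0 := by
  rw [LieAlgebra.derivedSeries_def, LieAlgebra.derivedSeriesOfIdeal_succ,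
    LieAlgebra.derivedSeriesOfIdeal_zero, ← LieSubmodule.mem_toSubmodule,
    LieSubmodule.lieIdeal_oper_eq_linear_span'] at hx
  induction hx using Submodule.span_induction with
  | mem x h =>
    obtain ⟨a, -, b, -, rfl⟩ := h
    rw [grad_lie]
    simp [constantCoeff_linPart]
  | zero => simp
  | add x y _ _ hx hy => rw [map_add, Pi.add_apply, map_add, hx, hy, add_zero]
  | smul c x _ hx =>
    rw [map_smul, Pi.smul_apply, MvPowerSeries.smul_eq_C_mul, map_mul, hx, mul_zero]

theorem mem_derived_of_grad_eq_koszul [CharZero K] (i k : Fin m) (h : MvPowerSeries (Fin m) K)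
    (x : Fhat m K) (hx : grad x = fun l => (if l = i then h * MvPowerSeries.X k else 0)
      - if l = k then h * MvPowerSeries.X i else 0) :
    x ∈ LieAlgebra.derivedSeries K (Fhat m K) 1 := by
  have hex : ∀ g : MvPowerSeries (Fin m) K, ∃ z : Fhat m K,
      grad z = fun l => (if l = i then g * MvPowerSeries.X k else 0)
        - if l = k then g * MvPowerSeries.X i else 0 := fun g =>
    exists_grad_eq_of_syzygy _ (by
      simp only [mul_sub, Finset.sum_sub_distrib, mul_ite, mul_zero, Finset.sum_ite_eq',
        Finset.mem_univ, if_true]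
      ring)
  choose z hz using hex
  have hzc : ∀ g, linPart (grad (z g)) = 0 := fun g => linPart_eq_zero fun l => by
    rw [hz]; dsimp only; split_ifs <;> simp
  have : x = MvPowerSeries.constantCoeff h • ⁅toHat m K (gen m K i), toHat m K (gen m K k)⁆
      + ∑ l, ⁅z (divMin l h), toHat m K (gen m K l)⁆ := by
    refine grad_injective (funext fun l => ?_)
    rw [map_add, map_sum, map_smul, Pi.add_apply, Finset.sum_apply, Pi.smul_apply, grad_lie,
      linPart_grad_gen, linPart_grad_gen, grad_gen, grad_gen]
    have h1 : ∀ j, grad ⁅z (divMin j h), toHat m K (gen m K j)⁆ l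
        = (MvPowerSeries.X j * divMin j h) * ((if l = i then MvPowerSeries.X k else 0)
          - if l = k then MvPowerSeries.X i else 0) := by
      intro j
      rw [grad_lie, linPart_grad_gen, hzc, mul_zero, sub_zero, hz]
      dsimp only
      split_ifs <;> ring
    rw [Finset.sum_congr rfl fun j _ => h1 j, ← Finset.sum_mul, sum_X_mul_divMin, hx,
      MvPowerSeries.smul_eq_C_mul, Pi.single_apply, Pi.single_apply]
    dsimp only
    split_ifs <;> ring
  rw [this]
  exact add_mem (Submodule.smul_mem _ _ (lie_mem_derived _ _))
    (sum_mem fun l _ => lie_mem_derived _ _)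

/-- The commutator ideal of the completion consists of the elements whose partial derivatives have
no constant terms. -/
theorem mem_derived_iff [CharZero K] (x : Fhat m K) :
    x ∈ LieAlgebra.derivedSeries K (Fhat m K) 1 ↔
      ∀ i, MvPowerSeries.constantCoeff (grad x i) = 0 := by
  refine ⟨constantCoeff_grad_of_mem, fun hx => ?_⟩
  have hrel : ∑ i, MvPowerSeries.X i * grad x i = 0 := by
    rw [grad_relation, linPart_eq_zero hx]
  -- the coefficients of `x` in terms of the `[y_i, y_k]`, from Euler's identity
  let g : Fin m → Fin m → MvPowerSeries (Fin m) K := fun i k d =>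
    ((d k + 1 : K) / (d.degree + 2)) * MvPowerSeries.coeff (d + Finsupp.single k 1) (grad x i)
  have hg : ∀ i k d, MvPowerSeries.coeff d (g i k) =
      ((d k + 1 : K) / (d.degree + 2)) *
        MvPowerSeries.coeff (d + Finsupp.single k 1) (grad x i) := fun _ _ _ => rfl
  have hex : ∀ i k, ∃ z : Fhat m K,
      grad z = fun l => (if l = i then g i k * MvPowerSeries.X k else 0)
        - if l = k then g i k * MvPowerSeries.X i else 0 := fun i k =>
    exists_grad_eq_of_syzygy _ (by
      simp only [mul_sub, Finset.sum_sub_distrib, mul_ite, mul_zero, Finset.sum_ite_eq',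
        Finset.mem_univ, if_true]
      ring)
  choose z hz using hex
  have : x = ∑ i, ∑ k, z i k := by
    refine grad_injective (funext fun l => ?_)
    simp only [map_sum, Finset.sum_apply, hz, Finset.sum_sub_distrib]
    rw [Finset.sum_comm (f := fun i k => if l = i then g i k * MvPowerSeries.X k else 0)]
    simp only [Finset.sum_ite_eq, Finset.mem_univ, if_true]
    refine MvPowerSeries.ext fun d => ?_
    have hd : (d.degree + 1 : K) ≠ 0 := degree_add_one_ne_zero d
    rw [map_sub, map_sum, map_sum]
    have hdeg : ∀ {i}, d i ≠ 0 → ((d - Finsupp.single i 1).degree : K) + 2 = d.degree + 1 := by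
      intro i hi
      have h3 := congrArg Finsupp.degree (sub_single_add_single hi)
      rw [map_add, Finsupp.degree_single] at h3
      rw [← h3]; push_cast; ring
    have h1 : ∀ k, MvPowerSeries.coeff d (g l k * MvPowerSeries.X k)
        = (d k : K) / (d.degree + 1) * MvPowerSeries.coeff d (grad x l) := by
      intro k
      rw [mul_comm, coeff_X_mul_eq_ite]
      by_cases hk : d k = 0
      · simp [hk]
      · rw [if_neg hk, hg, hdeg hk, sub_single_add_single hk]
        congr 2
        have : ((d - Finsupp.single k 1 : Fin m →₀ ℕ) k + 1 : ℕ) = d k := by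
          have := congrArg (fun e => e k) (sub_single_add_single hk)
          simpa using this
        exact_mod_cast this
    have h2 : ∀ i, MvPowerSeries.coeff d (g i l * MvPowerSeries.X i)
        = (d l + 1 : K) / (d.degree + 1) * MvPowerSeries.coeff (d + Finsupp.single l 1)
            (MvPowerSeries.X i * grad x i)
          - if i = l then MvPowerSeries.coeff d (grad x l) / (d.degree + 1) else 0 := by
      intro i
      rw [mul_comm, coeff_X_mul_eq_ite, coeff_X_mul_eq_ite]
      by_cases hil : i = l
      · subst hil
        rw [if_neg (by simp : ¬ (d + Finsupp.single i 1 : Fin m →₀ ℕ) i = 0),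
          add_tsub_cancel_right, if_pos rfl]
        by_cases hi : d i = 0
        · simp [hi]
          ring
        · have : ((d - Finsupp.single i 1 : Fin m →₀ ℕ) i + 1 : ℕ) = d i := by
            have := congrArg (fun e => e i) (sub_single_add_single hi)
            simpa using this
          rw [if_neg hi, hg, hdeg hi, sub_single_add_single hi]
          have h4 : (((d - Finsupp.single i 1 : Fin m →₀ ℕ) i : ℕ) + 1 : K) = d i := by
            exact_mod_cast this
          rw [h4]
          ring
      · have h5 : (d + Finsupp.single l 1 : Fin m →₀ ℕ) i = d i := by simp [hil]
        rw [h5, if_neg hil]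
        by_cases hi : d i = 0
        · simp [hi]
        · rw [if_neg hi, if_neg hi, hg, hdeg hi, sub_single_apply_of_ne d (Ne.symm hil), sub_zero]
          congr 3
          conv_rhs => rw [← sub_single_add_single hi, add_right_comm, add_tsub_cancel_right]
    rw [Finset.sum_congr rfl fun k _ => h1 k, Finset.sum_congr rfl fun i _ => h2 i,
      Finset.sum_sub_distrib, ← Finset.mul_sum, ← map_sum, hrel, ← Finset.sum_mul,
      ← Finset.sum_div, ← Nat.cast_sum, ← Finsupp.degree_eq_sum]
    simp only [Finset.sum_ite_eq', Finset.mem_univ, if_true, map_zero, mul_zero]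
    field_simp
    ring
  rw [this]
  exact sum_mem fun i _ => sum_mem fun k _ => mem_derived_of_grad_eq_koszul i k _ _ (hz i k)

end derived

section topology

open Filter Topology

variable {m : ℕ} {K : Type*} [Field K]

theorem nhds_eq (x : Fhat m K) : 𝓝 x = ⨅ k, 𝓟 {y | proj m K k y = proj m K k x} := by
  rw [nhds_iInf]
  refine iInf_congr fun k => ?_
  have h : @nhds _ ⊥ (proj m K k x) = pure (proj m K k x) :=
    congrFun (@nhds_discrete _ ⊥ (@DiscreteTopology.mk _ ⊥ rfl)) _
  rw [@nhds_induced _ _ ⊥, h, comap_pure]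
  rfl

theorem tendsto_nhds_iff {ι : Type*} {l : Filter ι} {u : ι → Fhat m K} {x : Fhat m K} :
    Tendsto u l (𝓝 x) ↔ ∀ k, ∀ᶠ n in l, proj m K k (u n) = proj m K k x := by
  simp only [nhds_eq, tendsto_iInf, tendsto_principal]
  rfl

theorem eventually_proj_eq (x : Fhat m K) (k : ℕ) :
    ∀ᶠ y in 𝓝 x, proj m K k y = proj m K k x := tendsto_nhds_iff.mp tendsto_id k

instance : T2Space (Fhat m K) := by
  refine t2_iff_nhds.mpr fun {x y} h => Subtype.ext (funext fun k => ?_)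
  have h1 := (eventually_proj_eq x k).filter_mono (inf_le_left : 𝓝 x ⊓ 𝓝 y ≤ _)
  have h2 := (eventually_proj_eq y k).filter_mono (inf_le_right : 𝓝 x ⊓ 𝓝 y ≤ _)
  obtain ⟨w, hw, hw'⟩ := (h1.and h2).exists
  exact hw.symm.trans hw'

theorem denseRange_toHat : DenseRange (toHat m K) := by
  intro x
  choose v hv _ using exists_approx x
  refine mem_closure_of_tendsto (f := fun k => toHat m K (v k)) (b := atTop) ?_
    (Eventually.of_forall fun k => ⟨_, rfl⟩)
  refine tendsto_nhds_iff.mpr fun k => ?_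
  filter_upwards [eventually_ge_atTop k] with n hn
  exact (hv n k hn).symm

end topology

/-! ### Exponentials of linear forms and inner matrices -/

section exponential

variable {m : ℕ} {K : Type*} [Field K]

/-- The linear form `∑ β_i t_i` as a power series. -/
def linSeries (β : Fin m → K) : MvPowerSeries (Fin m) K :=
  (Wreath.lin β : MvPolynomial (Fin m) K)

/-- The value `∑ c_n ℓ^n` of a power series in one variable at the linear form `ℓ = ∑ β_i t_i`;
the coefficient of `t^d` only comes from the summand with `n = |d|`. -/
def evalLin (c : ℕ → K) (β : Fin m → K) : MvPowerSeries (Fin m) K := fun d =>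
  c d.degree * (Wreath.lin β ^ d.degree).coeff d

theorem coeff_evalLin (c : ℕ → K) (β : Fin m → K) (d : Fin m →₀ ℕ) :
    MvPowerSeries.coeff d (evalLin c β) = c d.degree * (Wreath.lin β ^ d.degree).coeff d := rfl

theorem lin_isHomogeneous (β : Fin m → K) : (Wreath.lin β).IsHomogeneous 1 :=
  MvPolynomial.IsHomogeneous.sum _ _ _ fun i _ => by
    rw [MvPolynomial.smul_eq_C_mul]
    exact MvPolynomial.isHomogeneous_C_mul_X _ _

theorem coeff_lin_pow_eq_zero (β : Fin m → K) {n : ℕ} {d : Fin m →₀ ℕ} (h : d.degree ≠ n) :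
    (Wreath.lin β ^ n).coeff d = 0 :=
  ((lin_isHomogeneous β).pow n).coeff_eq_zero (by rwa [one_mul])

theorem coeff_linSeries_pow (β : Fin m → K) (n : ℕ) (d : Fin m →₀ ℕ) :
    MvPowerSeries.coeff d (linSeries β ^ n) = (Wreath.lin β ^ n).coeff d := by
  rw [linSeries, ← MvPolynomial.coe_pow, MvPolynomial.coeff_coe]

theorem agreeBelow_linSeries_pow (β : Fin m → K) {k n : ℕ} (h : k ≤ n) :
    AgreeBelow k (linSeries β ^ n) 0 := fun d hd => by
  rw [coeff_linSeries_pow, coeff_lin_pow_eq_zero β (by omega), map_zero]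

theorem evalLin_agree (c : ℕ → K) (β : Fin m → K) (N : ℕ) :
    AgreeBelow N (evalLin c β) (∑ n ∈ Finset.range N, c n • linSeries β ^ n) := by
  intro d hd
  rw [map_sum, Finset.sum_eq_single d.degree]
  · rw [coeff_evalLin, map_smul, coeff_linSeries_pow, smul_eq_mul]
  · intro n _ hn
    rw [map_smul, coeff_linSeries_pow, coeff_lin_pow_eq_zero β (Ne.symm hn), smul_zero]
  · intro h
    exact absurd (Finset.mem_range.mpr hd) h

/-- The power series `e^ℓ` for the linear form `ℓ = ∑ β_i t_i`. -/
def expLin (β : Fin m → K) : MvPowerSeries (Fin m) K := evalLin (fun n => (n.factorial : K)⁻¹) β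

/-- The power series `(e^ℓ - 1) / ℓ` for the linear form `ℓ = ∑ β_i t_i`. -/
def expQuot (β : Fin m → K) : MvPowerSeries (Fin m) K :=
  evalLin (fun n => ((n + 1).factorial : K)⁻¹) β

theorem expLin_eq (β : Fin m → K) : expLin β = 1 + linSeries β * expQuot β := by
  refine AgreeBelow.ext fun k => ?_
  have h1 := (evalLin_agree (fun n => (n.factorial : K)⁻¹) β (k + 1)).mono k.le_succ
  have h2 := evalLin_agree (fun n => ((n + 1).factorial : K)⁻¹) β k
  refine h1.trans (AgreeBelow.symm ?_)
  refine ((AgreeBelow.refl k 1).add ((AgreeBelow.refl k (linSeries β)).mul h2)).trans ?_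
  rw [Finset.sum_range_succ', Finset.mul_sum]
  simp only [mul_smul_comm, ← pow_succ']
  rw [add_comm]
  simp only [Nat.factorial_zero, Nat.cast_one, inv_one, pow_zero, one_smul]
  exact AgreeBelow.refl _ _

theorem expLin_zero : expLin (0 : Fin m → K) = 1 := by
  rw [expLin_eq, linSeries, Wreath.lin_zero]
  simp

theorem linSeries_eq_sum (β : Fin m → K) :
    linSeries β = ∑ i, MvPowerSeries.X i * MvPowerSeries.C (β i) := by
  have := linPart_eq_sum fun i => MvPowerSeries.C (σ := Fin m) (β i)
  simpa [linPart, linSeries] using this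

theorem constantCoeff_linSeries (β : Fin m → K) :
    MvPowerSeries.constantCoeff (linSeries β) = 0 := by
  simp [linSeries_eq_sum, map_sum]

theorem constantCoeff_expLin (β : Fin m → K) : MvPowerSeries.constantCoeff (expLin β) = 1 := by
  rw [expLin_eq]
  simp [constantCoeff_linSeries]

theorem constantCoeff_expQuot (β : Fin m → K) : MvPowerSeries.constantCoeff (expQuot β) = 1 := by
  rw [← MvPowerSeries.coeff_zero_eq_constantCoeff_apply, expQuot, coeff_evalLin]
  simp

theorem coeff_single_X_mul (i j : Fin m) (f : MvPowerSeries (Fin m) K) :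
    MvPowerSeries.coeff (Finsupp.single i 1) (MvPowerSeries.X j * f)
      = if j = i then MvPowerSeries.constantCoeff f else 0 := by
  rw [coeff_X_mul_eq_ite]
  by_cases h : j = i
  · subst h; simp
  · simp [h]

/-- The product rule for the coefficients of degree one. -/
theorem coeff_single_mul (i : Fin m) (f g : MvPowerSeries (Fin m) K) :
    MvPowerSeries.coeff (Finsupp.single i 1) (f * g)
      = MvPowerSeries.constantCoeff f * MvPowerSeries.coeff (Finsupp.single i 1) g
        + MvPowerSeries.coeff (Finsupp.single i 1) f * MvPowerSeries.constantCoeff g := by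
  classical
  rw [MvPowerSeries.coeff_mul, Finsupp.antidiagonal_single]
  simp [Finset.Nat.antidiagonal_succ]

theorem coeff_single_linSeries (i : Fin m) (β : Fin m → K) :
    MvPowerSeries.coeff (Finsupp.single i 1) (linSeries β) = β i := by
  simp only [linSeries_eq_sum, map_sum, coeff_single_X_mul]
  simp

theorem coeff_single_expLin (i : Fin m) (β : Fin m → K) :
    MvPowerSeries.coeff (Finsupp.single i 1) (expLin β) = β i := by
  classical
  rw [expLin_eq, map_add, coeff_single_mul, constantCoeff_linSeries, coeff_single_linSeries,
    constantCoeff_expQuot, MvPowerSeries.coeff_one]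
  simp

theorem expLin_add [CharZero K] (β γ : Fin m → K) : expLin (β + γ) = expLin β * expLin γ := by
  refine MvPowerSeries.ext fun d => ?_
  rw [expLin, coeff_evalLin, Wreath.lin_add, (Commute.all _ _).add_pow', MvPowerSeries.coeff_mul,
    MvPolynomial.coeff_sum, Finset.mul_sum]
  have h1 : ∀ p ∈ Finset.HasAntidiagonal.antidiagonal d.degree, ((d.degree.factorial : K)⁻¹ *
      (d.degree.choose p.1 • (Wreath.lin β ^ p.1 * Wreath.lin γ ^ p.2)).coeff d)
      = ∑ x ∈ Finset.HasAntidiagonal.antidiagonal d, (p.1.factorial : K)⁻¹ *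
        (p.2.factorial : K)⁻¹ *
          ((Wreath.lin β ^ p.1).coeff x.1 * (Wreath.lin γ ^ p.2).coeff x.2) := by
    intro p hp
    have h := Finset.HasAntidiagonal.mem_antidiagonal.mp hp
    have hfac : ∀ n : ℕ, (n.factorial : K) ≠ 0 := fun n => by
      exact_mod_cast n.factorial_ne_zero
    have h2 : (d.degree.factorial : K)⁻¹ * (d.degree.choose p.1 : K)
        = (p.1.factorial : K)⁻¹ * (p.2.factorial : K)⁻¹ := by
      have h3 := Nat.add_choose_mul_factorial_mul_factorial p.2 p.1
      rw [add_comm, h] at h3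
      have h4 : (d.degree.choose p.1 : K) * p.2.factorial * p.1.factorial = d.degree.factorial := by
        exact_mod_cast h3
      have := hfac d.degree
      have := hfac p.1
      have := hfac p.2
      field_simp
      linear_combination h4
    rw [← Nat.cast_smul_eq_nsmul K, MvPolynomial.coeff_smul, smul_eq_mul, ← mul_assoc, h2,
      MvPolynomial.coeff_mul, Finset.mul_sum]
  rw [Finset.sum_congr rfl h1, Finset.sum_comm]
  refine Finset.sum_congr rfl fun x hx => ?_
  have h := congrArg Finsupp.degree (Finset.HasAntidiagonal.mem_antidiagonal.mp hx)
  rw [map_add] at h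
  rw [Finset.sum_eq_single (x.1.degree, x.2.degree)]
  · rw [expLin, expLin, coeff_evalLin, coeff_evalLin]
    ring
  · intro p hp hne
    by_cases h1 : x.1.degree = p.1
    · have h2 : x.2.degree ≠ p.2 := fun h2 => hne (Prod.ext h1.symm h2.symm)
      rw [coeff_lin_pow_eq_zero γ h2, mul_zero, mul_zero]
    · rw [coeff_lin_pow_eq_zero β h1, zero_mul, mul_zero]
  · intro h'
    exact absurd (Finset.HasAntidiagonal.mem_antidiagonal.mpr h) h'

theorem expLin_neg_mul [CharZero K] (β : Fin m → K) : expLin (-β) * expLin β = 1 := by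
  rw [← expLin_add, neg_add_cancel, expLin_zero]

end exponential

section matrices

open Matrix

variable {m : ℕ} {K : Type*} [Field K]

/-- The vector `(t_1, …, t_m)` of the variables. -/
def tvec : Fin m → MvPowerSeries (Fin m) K := fun i => MvPowerSeries.X i

/-- The matrices which are Jacobian matrices of IA-automorphisms: those congruent to the identity
matrix modulo the variables and fixing the row `(t_1, …, t_m)`. They are called admissible below. -/
structure IsIAMatrix (J : Matrix (Fin m) (Fin m) (MvPowerSeries (Fin m) K)) : Prop where
  const : MvPowerSeries.constantCoeff.mapMatrix J = 1
  rel : tvec ᵥ* J = tvec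

/-- The matrices `e^ℓ - w t`, where `t = (t_1, …, t_m)`, `ℓ` is a linear form and
`t w = e^ℓ - 1`. They are the Jacobian matrices of the inner automorphisms. -/
def IsInnMatrix (M : Matrix (Fin m) (Fin m) (MvPowerSeries (Fin m) K)) : Prop :=
  ∃ (β : Fin m → K) (w : Fin m → MvPowerSeries (Fin m) K),
    tvec ⬝ᵥ w = expLin β - 1 ∧ M = expLin β • 1 - vecMulVec w tvec

variable {J M N : Matrix (Fin m) (Fin m) (MvPowerSeries (Fin m) K)}

theorem IsIAMatrix.const_apply (hJ : IsIAMatrix J) (i j : Fin m) :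
    MvPowerSeries.constantCoeff (J i j) = if i = j then 1 else 0 := by
  have := congrFun (congrFun hJ.const i) j
  rwa [Matrix.one_apply] at this

theorem IsIAMatrix.mul (hM : IsIAMatrix M) (hN : IsIAMatrix N) : IsIAMatrix (M * N) :=
  ⟨by rw [map_mul, hM.const, hN.const, one_mul], by rw [← vecMul_vecMul, hM.rel, hN.rel]⟩

theorem IsIAMatrix.exists_inverse (hJ : IsIAMatrix J) :
    ∃ J', IsIAMatrix J' ∧ J * J' = 1 ∧ J' * J = 1 := by
  have hdet : IsUnit J.det := by
    rw [MvPowerSeries.isUnit_iff_constantCoeff, RingHom.map_det, hJ.const, det_one]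
    exact isUnit_one
  have h1 := J.mul_nonsing_inv hdet
  have h2 := J.nonsing_inv_mul hdet
  refine ⟨J⁻¹, ⟨?_, ?_⟩, h1, h2⟩
  · have h3 := congrArg MvPowerSeries.constantCoeff.mapMatrix h1
    rwa [map_mul, hJ.const, one_mul, map_one] at h3
  · conv_lhs => rw [← hJ.rel]
    rw [vecMul_vecMul, h1, vecMul_one]

theorem constantCoeff_of_dotProduct {β : Fin m → K} {w : Fin m → MvPowerSeries (Fin m) K}
    (h : tvec ⬝ᵥ w = expLin β - 1) (i : Fin m) : MvPowerSeries.constantCoeff (w i) = β i := by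
  classical
  have h1 := congrArg (MvPowerSeries.coeff (Finsupp.single i 1)) h
  rw [map_sub, coeff_single_expLin, MvPowerSeries.coeff_one, dotProduct, map_sum] at h1
  simpa [tvec, coeff_single_X_mul] using h1

theorem IsInnMatrix.isIAMatrix (hM : IsInnMatrix M) : IsIAMatrix M := by
  obtain ⟨β, w, hw, rfl⟩ := hM
  refine ⟨?_, ?_⟩
  · ext i j
    simp [vecMulVec_apply, tvec, Matrix.one_apply, apply_ite, constantCoeff_expLin]
  · rw [vecMul_sub, vecMul_smul, vecMul_one, vecMul_vecMulVec, hw, sub_smul, one_smul,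
      sub_sub_cancel]

theorem IsInnMatrix.one : IsInnMatrix (1 : Matrix (Fin m) (Fin m) (MvPowerSeries (Fin m) K)) :=
  ⟨0, 0, by simp [expLin_zero], by simp [expLin_zero]⟩

theorem inn_mul_of_rel {β : Fin m → K} {w : Fin m → MvPowerSeries (Fin m) K}
    (hJ : tvec ᵥ* J = tvec) :
    (expLin β • 1 - vecMulVec w tvec) * J = expLin β • J - vecMulVec w tvec := by
  rw [sub_mul, smul_mul_assoc, one_mul, vecMulVec_mul, hJ]

theorem IsInnMatrix.mul [CharZero K] (hM : IsInnMatrix M) (hN : IsInnMatrix N) :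
    IsInnMatrix (M * N) := by
  have hN' := hN.isIAMatrix.rel
  obtain ⟨β, w, hw, rfl⟩ := hM
  rw [inn_mul_of_rel hN']
  obtain ⟨γ, z, hz, rfl⟩ := hN
  refine ⟨β + γ, w + expLin β • z, ?_, ?_⟩
  · rw [dotProduct_add, dotProduct_smul, hw, hz, expLin_add, smul_eq_mul]
    ring
  · rw [expLin_add, add_vecMulVec, smul_vecMulVec, smul_sub, smul_smul]
    abel

theorem IsInnMatrix.exists_inverse [CharZero K] (hM : IsInnMatrix M) :
    ∃ M', IsInnMatrix M' ∧ M' * M = 1 := by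
  have hM' := hM.isIAMatrix.rel
  obtain ⟨β, w, hw, rfl⟩ := hM
  refine ⟨_, ⟨-β, -(expLin (-β) • w), ?_, rfl⟩, ?_⟩
  · rw [dotProduct_neg, dotProduct_smul, hw, smul_eq_mul, mul_sub, expLin_neg_mul]
    ring
  · rw [inn_mul_of_rel hM', smul_sub, smul_smul, expLin_neg_mul, neg_vecMulVec, smul_vecMulVec,
      one_smul]
    abel

theorem IsInnMatrix.conj (hM : IsInnMatrix M) (hJ : IsIAMatrix J) (hJN : J * N = 1)
    (hN : IsIAMatrix N) : IsInnMatrix (J * M * N) := by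
  obtain ⟨β, w, hw, rfl⟩ := hM
  refine ⟨β, J *ᵥ w, by rw [dotProduct_mulVec, hJ.rel, hw], ?_⟩
  rw [mul_assoc, inn_mul_of_rel hN.rel, mul_sub, mul_smul_comm, hJN, mul_vecMulVec]

end matrices

/-! ### Normal forms of matrices -/

section normalForm

open Matrix

variable {m : ℕ} {K : Type*} [Field K]

theorem InVars.sub {S : Set (Fin m)} {f g : MvPowerSeries (Fin m) K} (hf : InVars S f)
    (hg : InVars S g) : InVars S (f - g) := by
  intro d hd j hj
  by_cases h : MvPowerSeries.coeff d f = 0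
  · refine hg d (fun h' => hd ?_) j hj
    rw [map_sub, h, h', sub_zero]
  · exact hf d h j hj

theorem InVars.sum {S : Set (Fin m)} {ι : Type*} {s : Finset ι}
    {f : ι → MvPowerSeries (Fin m) K} (hf : ∀ i ∈ s, InVars S (f i)) :
    InVars S (∑ i ∈ s, f i) := by
  intro d hd j hj
  rw [map_sum] at hd
  obtain ⟨i, hi, hne⟩ := Finset.exists_ne_zero_of_sum_ne_zero hd
  exact hf i hi d hne j hj

theorem InVars.one (S : Set (Fin m)) : InVars S (1 : MvPowerSeries (Fin m) K) := by
  classical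
  intro d hd j hj
  rw [MvPowerSeries.coeff_one] at hd
  have : d = 0 := by
    by_contra h
    exact hd (if_neg h)
  subst this
  exact absurd rfl hj

theorem InVars.X_mul {S : Set (Fin m)} {f : MvPowerSeries (Fin m) K} (hf : InVars S f) {i : Fin m}
    (hi : i ∈ S) : InVars S (MvPowerSeries.X i * f) := by
  intro d hd j hj
  rw [coeff_X_mul_eq_ite] at hd
  by_cases hji : j = i
  · rwa [hji]
  · by_cases hdi : d i = 0
    · exact absurd (if_pos hdi) hd
    · rw [if_neg hdi] at hd
      exact hf _ hd j (by rwa [sub_single_apply_of_ne d hji])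

/-- A series without the variable `t_i` that is divisible by `t_i` vanishes. -/
theorem eq_zero_of_X_mul_inVars {S : Set (Fin m)} {i : Fin m} (hi : i ∉ S)
    {g : MvPowerSeries (Fin m) K} (h : InVars S (MvPowerSeries.X i * g)) : g = 0 := by
  refine MvPowerSeries.ext fun d => ?_
  by_contra hd
  refine hi (h (d + Finsupp.single i 1) ?_ i (by simp))
  rw [coeff_X_mul_eq_ite, if_neg (by simp), add_tsub_cancel_right]
  exact hd

theorem eq_zero_and_eq_zero_of_X_mul_eq {S : Set (Fin m)} {i : Fin m} (hi : i ∉ S)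
    {f g : MvPowerSeries (Fin m) K} (hf : InVars S f) (h : MvPowerSeries.X i * g = f) :
    g = 0 ∧ f = 0 := by
  subst h
  have hg := eq_zero_of_X_mul_inVars hi hf
  exact ⟨hg, by rw [hg, mul_zero]⟩

theorem sum_eq_first_add {A : Type*} [AddCommMonoid A] (hm : 0 < m) (F : Fin m → A) :
    ∑ i, F i = F ⟨0, hm⟩ + ∑ i ∈ Finset.Ioi (⟨0, hm⟩ : Fin m), F i := by
  have : (Finset.univ : Finset (Fin m)) = insert ⟨0, hm⟩ (Finset.Ioi ⟨0, hm⟩) := by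
    ext i
    simp only [Finset.mem_univ, Finset.mem_insert, Finset.mem_Ioi, true_iff]
    rcases Nat.eq_zero_or_pos i.1 with h | h
    · exact Or.inl (Fin.ext h)
    · exact Or.inr h
  rw [this, Finset.sum_insert (by simp)]

theorem eq_first_or_gt (hm : 0 < m) (i : Fin m) : i = ⟨0, hm⟩ ∨ (⟨0, hm⟩ : Fin m) < i := by
  rcases Nat.eq_zero_or_pos i.1 with h | h
  · exact Or.inl (Fin.ext h)
  · exact Or.inr h

theorem divMin_first_decomp (hm : 0 < m) (f : MvPowerSeries (Fin m) K) :
    InVars {l | (⟨0, hm⟩ : Fin m) < l} (f - MvPowerSeries.X ⟨0, hm⟩ * divMin ⟨0, hm⟩ f) := by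
  intro d hd j hj
  rcases eq_first_or_gt hm j with rfl | h
  · refine absurd ?_ hd
    rw [map_sub, coeff_X_mul_eq_ite, if_neg hj, coeff_divMin, if_pos, sub_single_add_single hj,
      sub_self]
    intro j hj
    exact absurd hj (Nat.not_lt_zero _)
  · exact h

theorem divMin_eq_zero_of_inVars {S : Set (Fin m)} {i : Fin m} (hi : i ∉ S)
    {f : MvPowerSeries (Fin m) K} (hf : InVars S f) : divMin i f = 0 := by
  refine MvPowerSeries.ext fun d => ?_
  rw [coeff_divMin]
  split_ifs
  · by_contra h
    exact hi (hf _ h i (by simp))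
  · rfl

variable {J M : Matrix (Fin m) (Fin m) (MvPowerSeries (Fin m) K)}

theorem IsIAMatrix.sum_X_mul (hJ : IsIAMatrix J) (j : Fin m) :
    ∑ i, MvPowerSeries.X i * J i j = MvPowerSeries.X j := congrFun hJ.rel j

/-- A matrix in normal form is the Jacobian matrix of an IA-automorphism. -/
theorem HasNormalForm.isIAMatrix {hm : 2 ≤ m} (h : HasNormalForm hm J) : IsIAMatrix J := by
  obtain ⟨s, q, r, f, rfl, hs, hqr, hf, -, -, -, hsq, hr, hfrel, -⟩ := h
  have hm' : 0 < m := by omega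
  refine ⟨?_, ?_⟩
  · rw [map_add, map_one, add_eq_left]
    ext i j
    rw [RingHom.mapMatrix_apply, Matrix.map_apply, Matrix.of_apply, Matrix.zero_apply]
    rcases eq_first_or_gt hm' j with rfl | hj
    · rw [if_pos rfl]
      rcases eq_first_or_gt hm' i with rfl | hi
      · rw [if_pos rfl, hs]
      · rw [if_neg hi.ne', map_add, map_mul, (hqr i hi).1, (hqr i hi).2, mul_zero, add_zero]
    · rw [if_neg hj.ne', hf i j hj]
  · rw [vecMul_add, vecMul_one, add_eq_left]
    funext j
    change ∑ i : Fin m, MvPowerSeries.X i * _ = 0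
    simp only [Matrix.of_apply]
    rcases eq_first_or_gt hm' j with rfl | hj
    · rw [sum_eq_first_add hm']
      simp only [if_true]
      rw [Finset.sum_congr rfl fun i hi => by rw [if_neg (Finset.mem_Ioi.mp hi).ne', mul_add,
        mul_left_comm], Finset.sum_add_distrib, hr, ← Finset.mul_sum, add_zero, ← mul_add, hsq,
        mul_zero]
    · simp only [if_neg hj.ne']
      exact hfrel j hj

/-- Every Jacobian matrix of an IA-automorphism is brought to normal form by an inner one. -/
theorem exists_inn_mul_hasNormalForm (hm : 2 ≤ m) (hJ : IsIAMatrix J) :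
    ∃ M, IsInnMatrix M ∧ HasNormalForm hm (M * J) := by
  have hm' : 0 < m := by omega
  let i₁ : Fin m := ⟨0, hm'⟩
  let i₂ : Fin m := ⟨1, by omega⟩
  have h12 : i₁ < i₂ := Nat.zero_lt_one
  -- the condition on `f₁₂` forces `β₁`, those on the constant terms of the `q_i` the other `β_i`
  let β : Fin m → K := fun i => if i = i₁ then
    MvPowerSeries.coeff (Finsupp.single i₂ 1) (J i₁ i₂) else
    -MvPowerSeries.coeff (Finsupp.single i 1) (J i₁ i₁)
  let a : Fin m → MvPowerSeries (Fin m) K := fun i => expLin β * J i i₁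
  let b : Fin m → MvPowerSeries (Fin m) K := fun i => a i - MvPowerSeries.X i₁ * divMin i₁ (a i)
  have hb : ∀ i, InVars {l | i₁ < l} (b i) := fun i => divMin_first_decomp hm' (a i)
  have ha0 : ∀ i, MvPowerSeries.constantCoeff (a i) = if i = i₁ then 1 else 0 := fun i => by
    rw [map_mul, constantCoeff_expLin, one_mul, hJ.const_apply]
  have hb0 : ∀ i, MvPowerSeries.constantCoeff (b i) = if i = i₁ then 1 else 0 := fun i => by
    rw [map_sub, ha0, map_mul, MvPowerSeries.constantCoeff_X, zero_mul, sub_zero]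
  let s : MvPowerSeries (Fin m) K := b i₁ - 1
  have hs : InVars {l | i₁ < l} s := (hb i₁).sub (InVars.one _)
  have hs0 : MvPowerSeries.constantCoeff s = 0 := by
    rw [map_sub, hb0, if_pos rfl, map_one, sub_self]
  let q : Fin m → MvPowerSeries (Fin m) K := fun i => -divMin i s
  have hi₁ : i₁ ∉ {l | i₁ < l} := lt_irrefl i₁
  have hsq : s + ∑ i ∈ Finset.Ioi i₁, MvPowerSeries.X i * q i = 0 := by
    have h := sum_X_mul_divMin s
    rw [sum_eq_first_add hm', divMin_eq_zero_of_inVars hi₁ hs, hs0, map_zero, sub_zero, mul_zero,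
      zero_add] at h
    simp only [q, mul_neg, Finset.sum_neg_distrib]
    rw [h, add_neg_cancel]
  have hq0 : ∀ i > i₁, MvPowerSeries.constantCoeff (q i) = 0 := by
    classical
    intro i hi
    rw [map_neg, ← MvPowerSeries.coeff_zero_eq_constantCoeff_apply, coeff_divMin,
      if_pos (by intro _ _; rfl), zero_add, map_sub, map_sub, coeff_single_X_mul, if_neg hi.ne,
      sub_zero, coeff_single_mul, constantCoeff_expLin, coeff_single_expLin, hJ.const_apply,
      if_pos rfl, MvPowerSeries.coeff_one, if_neg (by simp)]
    simp only [β, if_neg hi.ne']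
    ring
  have hrel : expLin β * MvPowerSeries.X i₁
      = MvPowerSeries.X i₁ * a i₁ + ∑ i ∈ Finset.Ioi i₁, MvPowerSeries.X i * a i := by
    rw [← sum_eq_first_add hm' fun i => MvPowerSeries.X i * a i, ← hJ.sum_X_mul i₁, Finset.mul_sum]
    exact Finset.sum_congr rfl fun i _ => mul_left_comm _ _ _
  have hsplit : MvPowerSeries.X i₁ * (expLin β - a i₁
        - ∑ i ∈ Finset.Ioi i₁, MvPowerSeries.X i * divMin i₁ (a i))
      = ∑ i ∈ Finset.Ioi i₁, MvPowerSeries.X i * b i := by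
    simp only [b, mul_sub, Finset.sum_sub_distrib, mul_left_comm _ (MvPowerSeries.X i₁)]
    rw [← Finset.mul_sum]
    linear_combination hrel
  obtain ⟨hE, hr⟩ := eq_zero_and_eq_zero_of_X_mul_eq hi₁
    (InVars.sum fun i hi => (hb i).X_mul (Finset.mem_Ioi.mp hi)) hsplit
  -- `w` removes from the first column what is divisible by `t_1` and not of the form `t_1 q_i`
  let w : Fin m → MvPowerSeries (Fin m) K := fun i =>
    if i = i₁ then divMin i₁ (a i₁) else divMin i₁ (a i) - q i
  have hw : tvec ⬝ᵥ w = expLin β - 1 := by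
    change ∑ i, MvPowerSeries.X i * w i = _
    rw [sum_eq_first_add hm']
    have h1 : ∀ i ∈ Finset.Ioi i₁, MvPowerSeries.X i * w i
        = MvPowerSeries.X i * divMin i₁ (a i) - MvPowerSeries.X i * q i := fun i hi => by
      simp only [w, if_neg (Finset.mem_Ioi.mp hi).ne', mul_sub]
    rw [Finset.sum_congr rfl h1, Finset.sum_sub_distrib]
    have h2 : w i₁ = divMin i₁ (a i₁) := if_pos rfl
    rw [h2]
    have h3 : s = a i₁ - MvPowerSeries.X i₁ * divMin i₁ (a i₁) - 1 := rfl
    linear_combination -hE - hsq + h3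
  refine ⟨_, ⟨β, w, hw, rfl⟩, ?_⟩
  have hM : IsIAMatrix ((expLin β • 1 - vecMulVec w tvec) * J) :=
    IsIAMatrix.mul (IsInnMatrix.isIAMatrix ⟨β, w, hw, rfl⟩) hJ
  have hentry : ∀ i j, ((expLin β • 1 - vecMulVec w tvec) * J) i j
      = expLin β * J i j - w i * MvPowerSeries.X j := by
    intro i j
    rw [inn_mul_of_rel hJ.rel]
    simp [vecMulVec_apply, tvec]
  set A := (expLin β • 1 - vecMulVec w tvec) * J with hA
  refine ⟨s, q, b, fun i j => (A - 1) i j, ?_, hs0, fun i hi => ⟨hq0 i hi, ?_⟩, ?_, hs,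
    fun i hi => ?_, fun i _ => hb i, hsq, hr, ?_, ?_⟩
  · ext1 i j
    rw [Matrix.add_apply, Matrix.of_apply]
    split_ifs with hj hi
    · subst hj hi
      rw [hentry, Matrix.one_apply_eq]
      have h2 : w i₁ = divMin i₁ (a i₁) := if_pos rfl
      have h3 : s = a i₁ - MvPowerSeries.X i₁ * divMin i₁ (a i₁) - 1 := rfl
      change expLin β * J i₁ i₁ - w i₁ * MvPowerSeries.X i₁ = 1 + s
      rw [h2, h3]
      ring
    · subst hj
      rw [hentry, Matrix.one_apply_ne hi]
      have h2 : w i = divMin i₁ (a i) - q i := if_neg hi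
      change expLin β * J i i₁ - w i * MvPowerSeries.X i₁ = 0 + (MvPowerSeries.X i₁ * q i
        + (a i - MvPowerSeries.X i₁ * divMin i₁ (a i)))
      rw [h2]
      ring
    · exact (add_sub_cancel
        ((1 : Matrix (Fin m) (Fin m) (MvPowerSeries (Fin m) K)) i j) (A i j)).symm
  · rw [hb0, if_neg hi.ne']
  · intro i j _
    change MvPowerSeries.constantCoeff
      (A i j - (1 : Matrix (Fin m) (Fin m) (MvPowerSeries (Fin m) K)) i j) = 0
    rw [map_sub, hM.const_apply, Matrix.one_apply]
    split_ifs <;> simp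
  · intro d hd
    refine divMin_inVars i s d fun h => hd ?_
    rw [map_neg, h, neg_zero]
  · intro j _
    have h := hM.sum_X_mul j
    simp only [Matrix.sub_apply, mul_sub, Finset.sum_sub_distrib, h, Matrix.one_apply]
    simp
  · classical
    change MvPowerSeries.coeff (Finsupp.single i₂ 1) ((A - 1) i₁ i₂) = 0
    rw [Matrix.sub_apply, hentry, Matrix.one_apply_ne h12.ne, sub_zero, map_sub, coeff_single_mul,
      constantCoeff_expLin, hJ.const_apply, if_neg h12.ne, mul_comm (w i₁), coeff_single_X_mul,
      if_pos rfl, constantCoeff_of_dotProduct hw]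
    simp [β]

/-- Two matrices in normal form that differ by an inner one coincide. -/
theorem hasNormalForm_unique {hm : 2 ≤ m} (hM : IsInnMatrix M) (hJ : HasNormalForm hm J)
    (hMJ : HasNormalForm hm (M * J)) : M * J = J := by
  classical
  have hm' : 0 < m := by omega
  have hIA := hJ.isIAMatrix
  obtain ⟨β, w, hw, rfl⟩ := hM
  have hentry : ∀ i j, ((expLin β • 1 - vecMulVec w tvec) * J) i j
      = expLin β * J i j - w i * MvPowerSeries.X j := by
    intro i j
    rw [inn_mul_of_rel hIA.rel]
    simp [vecMulVec_apply, tvec]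
  obtain ⟨s, q, r, f, hJeq, -, hqr, -, hsV, hqV, hrV, hsq, -, -, hf⟩ := hJ
  obtain ⟨s', q', r', f', hJeq', -, hqr', -, hsV', hqV', hrV', hsq', -, -, hf'⟩ := hMJ
  let i₁ : Fin m := ⟨0, hm'⟩
  let i₂ : Fin m := ⟨1, by omega⟩
  have h12 : i₁ < i₂ := Nat.zero_lt_one
  have hw0 := constantCoeff_of_dotProduct hw
  have hi₁ : i₁ ∉ {l | i₁ < l} := lt_irrefl i₁
  -- the entry `f₁₂` determines `β₁`
  have hβ₁ : β i₁ = 0 := by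
    have e1 : J i₁ i₂ = f i₁ i₂ := by
      rw [hJeq, Matrix.add_apply, Matrix.of_apply, if_neg h12.ne', Matrix.one_apply_ne h12.ne,
        zero_add]
    have e2 : expLin β * J i₁ i₂ - w i₁ * MvPowerSeries.X i₂ = f' i₁ i₂ := by
      rw [← hentry, hJeq', Matrix.add_apply, Matrix.of_apply, if_neg h12.ne',
        Matrix.one_apply_ne h12.ne, zero_add]
    have e3 := congrArg (MvPowerSeries.coeff (Finsupp.single i₂ 1)) e2
    have e4 : MvPowerSeries.coeff (Finsupp.single i₂ 1) (J i₁ i₂) = 0 := by rw [e1]; exact hf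
    have e5 : MvPowerSeries.coeff (Finsupp.single i₂ 1) (f' i₁ i₂) = 0 := hf'
    rw [map_sub, coeff_single_mul, constantCoeff_expLin, hIA.const_apply, if_neg h12.ne,
      mul_comm (w i₁), coeff_single_X_mul, if_pos rfl, hw0, e4, e5] at e3
    simpa using e3
  have hJ11 : J i₁ i₁ = 1 + s := by
    rw [hJeq, Matrix.add_apply, Matrix.of_apply, if_pos rfl, if_pos rfl, Matrix.one_apply_eq]
  have hMJ11 : expLin β * J i₁ i₁ - w i₁ * MvPowerSeries.X i₁ = 1 + s' := by
    rw [← hentry, hJeq', Matrix.add_apply, Matrix.of_apply, if_pos rfl, if_pos rfl,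
      Matrix.one_apply_eq]
  -- the linear terms of `s` are governed by the constant terms of the `q_i`
  have hlin : ∀ (s : MvPowerSeries (Fin m) K) (q r : Fin m → MvPowerSeries (Fin m) K),
      (∀ i > i₁, MvPowerSeries.constantCoeff (q i) = 0 ∧ MvPowerSeries.constantCoeff (r i) = 0) →
      s + ∑ i ∈ Finset.Ioi i₁, MvPowerSeries.X i * q i = 0 →
      ∀ i, MvPowerSeries.coeff (Finsupp.single i 1) s = 0 := by
    intro s q r hq hs i
    have h := congrArg (MvPowerSeries.coeff (Finsupp.single i 1)) hs
    rw [map_add, map_sum, Finset.sum_eq_zero, add_zero, map_zero] at h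
    · exact h
    · intro j hj
      rw [coeff_single_X_mul, (hq j (Finset.mem_Ioi.mp hj)).1, ite_self]
  have hβ : β = 0 := by
    funext i
    rcases eq_first_or_gt hm' i with rfl | hi
    · exact hβ₁
    · have e := congrArg (MvPowerSeries.coeff (Finsupp.single i 1)) hMJ11
      have hi' : i₁ ≠ i := ne_of_lt hi
      rw [map_sub, map_add, coeff_single_mul, constantCoeff_expLin, coeff_single_expLin,
        mul_comm (w i₁), coeff_single_X_mul, if_neg hi', hlin s' q' r' hqr' hsq', hJ11, map_add,
        hlin s q r hqr hsq, ← hJ11, hIA.const_apply, if_pos rfl, MvPowerSeries.coeff_one,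
        if_neg (by simp)] at e
      simpa using e
  subst hβ
  rw [expLin_zero, one_mul] at hMJ11
  obtain ⟨hw₁, hss⟩ := eq_zero_and_eq_zero_of_X_mul_eq (g := w i₁) hi₁ (hsV.sub hsV')
    (by linear_combination hJ11 - hMJ11)
  have hqq : ∀ i > i₁, q i = q' i := by
    intro i hi
    have key : ∀ (s : MvPowerSeries (Fin m) K) (q : Fin m → MvPowerSeries (Fin m) K),
        (∀ i > i₁, InVars {l | i ≤ l} (q i)) →
        s + ∑ i ∈ Finset.Ioi i₁, MvPowerSeries.X i * q i = 0 →
        ∀ d : Fin m →₀ ℕ, (∀ j < i, d j = 0) → MvPowerSeries.coeff d (q i)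
          = MvPowerSeries.coeff (d + Finsupp.single i 1) (-s) := by
      intro s q hq hs d hd
      let p : Fin m → MvPowerSeries (Fin m) K := fun l => if l = i₁ then 0 else q l
      have hp : ∀ l, InVars {j | l ≤ j} (p l) := by
        intro l
        rcases eq_first_or_gt hm' l with rfl | hl
        · intro d hd
          exact absurd (by simp [p, i₁]) hd
        · simp only [p, if_neg (ne_of_gt hl : l ≠ i₁)]
          exact hq l hl
      have h1 := coeff_eq_of_sum_X_mul hp hd
      have h2 : ∑ l, MvPowerSeries.X l * p l = -s := by
        rw [sum_eq_first_add hm', eq_neg_iff_add_eq_zero, ← hs, add_comm s]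
        have h3 : p ⟨0, hm'⟩ = 0 := if_pos rfl
        rw [h3, mul_zero, zero_add]
        congr 1
        exact Finset.sum_congr rfl fun l hl => by
          simp only [p, if_neg (Finset.mem_Ioi.mp hl).ne']
      have h4 : p i = q i := if_neg (ne_of_gt hi)
      rw [← h2, ← h4]
      exact h1
    refine MvPowerSeries.ext fun d => ?_
    by_cases hd : ∀ j < i, d j = 0
    · rw [key s q hqV hsq d hd, key s' q' hqV' hsq' d hd, sub_eq_zero.mp hss]
    · push Not at hd
      obtain ⟨j, hj, hdj⟩ := hd
      have hz : ∀ q : Fin m → MvPowerSeries (Fin m) K, InVars {l | i ≤ l} (q i) →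
          MvPowerSeries.coeff d (q i) = 0 := fun q hq => by
        by_contra h
        exact absurd (hq d h j hdj) (not_le.mpr hj)
      rw [hz q (hqV i hi), hz q' (hqV' i hi)]
  have hw' : w = 0 := by
    funext i
    rcases eq_first_or_gt hm' i with rfl | hi
    · exact hw₁
    · have hi' : i ≠ i₁ := ne_of_gt hi
      have e1 : J i i₁ = MvPowerSeries.X i₁ * q i + r i := by
        rw [hJeq, Matrix.add_apply, Matrix.of_apply, if_pos rfl, if_neg hi',
          Matrix.one_apply_ne hi', zero_add]
      have e2 : J i i₁ - w i * MvPowerSeries.X i₁ = MvPowerSeries.X i₁ * q' i + r' i := by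
        have := hentry i i₁
        rw [expLin_zero, one_mul] at this
        rw [← this, ← expLin_zero, hJeq', Matrix.add_apply, Matrix.of_apply, if_pos rfl,
          if_neg hi', Matrix.one_apply_ne hi', zero_add]
      refine (eq_zero_and_eq_zero_of_X_mul_eq (g := w i) hi₁ ((hrV i hi).sub (hrV' i hi)) ?_).1
      linear_combination e1 - e2 + MvPowerSeries.X i₁ * hqq i hi
  subst hw'
  rw [expLin_zero, one_smul, zero_vecMulVec, sub_zero, one_mul]

end normalForm

/-! ### Automorphisms and their Jacobian matrices -/

section automorphisms

open Matrix Filter Topology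

variable {m : ℕ} {K : Type*} [Field K]

theorem jacobian_eq (φ : Fhat m K ≃L[K] Fhat m K) (i j : Fin m) :
    jacobian φ i j = grad (φ (toHat m K (gen m K j))) i := rfl

theorem tvec_dotProduct_grad (x : Fhat m K) : tvec ⬝ᵥ grad x = linPart (grad x) := grad_relation x

theorem IsIAMatrix.constantCoeff_mulVec {J : Matrix (Fin m) (Fin m) (MvPowerSeries (Fin m) K)}
    (hJ : IsIAMatrix J) (f : Fin m → MvPowerSeries (Fin m) K) (i : Fin m) :
    MvPowerSeries.constantCoeff ((J *ᵥ f) i) = MvPowerSeries.constantCoeff (f i) := by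
  simp [mulVec, dotProduct, map_sum, hJ.const_apply]

theorem IsIAMatrix.linPart_mulVec {J : Matrix (Fin m) (Fin m) (MvPowerSeries (Fin m) K)}
    (hJ : IsIAMatrix J) (f : Fin m → MvPowerSeries (Fin m) K) : linPart (J *ᵥ f) = linPart f :=
  linPart_congr (hJ.constantCoeff_mulVec f)

theorem AgreeBelow.mulVec {k : ℕ} (J : Matrix (Fin m) (Fin m) (MvPowerSeries (Fin m) K))
    {f g : Fin m → MvPowerSeries (Fin m) K} (h : ∀ i, AgreeBelow k (f i) (g i)) (i : Fin m) :
    AgreeBelow k ((J *ᵥ f) i) ((J *ᵥ g) i) := by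
  change AgreeBelow k (∑ j, J i j * f j) (∑ j, J i j * g j)
  exact AgreeBelow.sum fun j _ => (AgreeBelow.refl k _).mul (h j)

theorem continuous_of_grad_eq_mulVec [CharZero K] {φ : Fhat m K → Fhat m K}
    {J : Matrix (Fin m) (Fin m) (MvPowerSeries (Fin m) K)}
    (h : ∀ x, grad (φ x) = J *ᵥ grad x) : Continuous φ := by
  refine continuous_iff_continuousAt.mpr fun x => tendsto_nhds_iff.mpr fun k => ?_
  filter_upwards [eventually_proj_eq x k] with y hy
  refine (proj_eq_iff k _ _).mpr fun i => ?_
  rw [h, h]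
  exact AgreeBelow.mulVec J ((proj_eq_iff k _ _).mp hy) i

/-- Every admissible matrix is realized by a linear endomorphism. -/
theorem exists_linearMap_of_matrix [CharZero K]
    {J : Matrix (Fin m) (Fin m) (MvPowerSeries (Fin m) K)} (hJ : IsIAMatrix J) :
    ∃ φ : Fhat m K →ₗ[K] Fhat m K, ∀ x, grad (φ x) = J *ᵥ grad x := by
  have hex : ∀ x : Fhat m K, ∃ y : Fhat m K, grad y = J *ᵥ grad x := fun x =>
    exists_grad_eq _ (by
      rw [hJ.linPart_mulVec, ← tvec_dotProduct_grad]
      conv_rhs => rw [← hJ.rel, ← dotProduct_mulVec]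
      rfl)
  choose φ hφ using hex
  refine ⟨⟨⟨φ, fun x y => grad_injective ?_⟩, fun c x => grad_injective ?_⟩, hφ⟩
  · rw [map_add, hφ, hφ, hφ, map_add, mulVec_add]
  · change grad (φ (c • x)) = grad (c • φ x)
    rw [map_smul, hφ, hφ, map_smul, mulVec_smul]

theorem mem_contAut_of_grad_eq_mulVec [CharZero K] {φ : Fhat m K ≃L[K] Fhat m K}
    {J : Matrix (Fin m) (Fin m) (MvPowerSeries (Fin m) K)} (hJ : IsIAMatrix J)
    (h : ∀ x, grad (φ x) = J *ᵥ grad x) : φ ∈ contAut m K := by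
  intro u v
  refine grad_injective (funext fun i => ?_)
  rw [h, grad_lie, h, h, hJ.linPart_mulVec, hJ.linPart_mulVec]
  have : grad ⁅u, v⁆ = linPart (grad v) • grad u - linPart (grad u) • grad v := by
    funext i
    rw [grad_lie, Pi.sub_apply, Pi.smul_apply, Pi.smul_apply, smul_eq_mul, smul_eq_mul]
    ring
  rw [this, mulVec_sub, mulVec_smul, mulVec_smul, Pi.sub_apply, Pi.smul_apply, Pi.smul_apply,
    smul_eq_mul, smul_eq_mul]
  ring

/-- The chain rule: a continuous automorphism with an admissible Jacobian matrix acts on gradients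
as multiplication by that matrix. -/
theorem grad_apply [CharZero K] {φ : Fhat m K ≃L[K] Fhat m K} (hφ : φ ∈ contAut m K)
    (hJ : IsIAMatrix (jacobian φ)) (x : Fhat m K) : grad (φ x) = jacobian φ *ᵥ grad x := by
  obtain ⟨ψ, hψ⟩ := exists_linearMap_of_matrix hJ
  -- the formula holds on the dense subalgebra `F_m`, which is generated by the `y_j`, and both
  -- sides are continuous
  let A : LieSubalgebra K (F m K) :=
    { carrier := {v | grad (φ (toHat m K v)) = jacobian φ *ᵥ grad (toHat m K v)}
      zero_mem' := by
        have : toHat m K 0 = 0 := rfl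
        rw [Set.mem_ofPred_eq, this, map_zero, map_zero, mulVec_zero]
      add_mem' := by
        intro v w hv hw
        have : toHat m K (v + w) = toHat m K v + toHat m K w := rfl
        rw [Set.mem_ofPred_eq] at hv hw ⊢
        rw [this, map_add, map_add, map_add, mulVec_add, hv, hw]
      smul_mem' := by
        intro c v hv
        have : toHat m K (c • v) = c • toHat m K v := rfl
        rw [Set.mem_ofPred_eq] at hv ⊢
        rw [this, map_smul, map_smul, map_smul, mulVec_smul, hv]
      lie_mem' := by
        intro v w hv hw
        have : toHat m K ⁅v, w⁆ = ⁅toHat m K v, toHat m K w⁆ := rfl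
        change grad _ = _ at hv hw
        change grad _ = _
        have h2 : ∀ u v : Fhat m K,
            grad ⁅u, v⁆ = linPart (grad v) • grad u - linPart (grad u) • grad v := by
          intro u v
          funext i
          rw [grad_lie, Pi.sub_apply, Pi.smul_apply, Pi.smul_apply, smul_eq_mul, smul_eq_mul]
          ring
        rw [this, hφ, h2, h2, hv, hw, hJ.linPart_mulVec, hJ.linPart_mulVec, mulVec_sub,
          mulVec_smul, mulVec_smul] }
  have hA : ∀ v, grad (φ (toHat m K v)) = jacobian φ *ᵥ grad (toHat m K v) :=
    lieSubalgebra_eq_top A fun j => by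
      change grad _ = _
      rw [grad_gen, mulVec_single_one]
      rfl
  have hfun : (φ : Fhat m K → Fhat m K) = ψ :=
    denseRange_toHat.equalizer φ.continuous (continuous_of_grad_eq_mulVec hψ)
      (funext fun v => grad_injective (by
        rw [Function.comp_apply, Function.comp_apply, hA, hψ]))
  rw [congrFun hfun x, hψ]

theorem mem_IA_iff [CharZero K] {φ : Fhat m K ≃L[K] Fhat m K} :
    φ ∈ IA m K ↔ φ ∈ contAut m K ∧ IsIAMatrix (jacobian φ) := by
  constructor
  · rintro ⟨h1, h2⟩
    have hc : ∀ i j, MvPowerSeries.constantCoeff (jacobian φ i j)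
        = (1 : Matrix (Fin m) (Fin m) K) i j := by
      intro i j
      have h3 := constantCoeff_grad_of_mem (h2 (toHat m K (gen m K j))) i
      rw [map_sub, Pi.sub_apply, map_sub, grad_gen, sub_eq_zero] at h3
      rw [jacobian_eq, h3, Pi.single_apply, Matrix.one_apply]
      split_ifs <;> simp
    refine ⟨h1, Matrix.ext fun i j => hc i j, funext fun j => ?_⟩
    change ∑ i : Fin m, MvPowerSeries.X i * grad (φ (toHat m K (gen m K j))) i = _
    rw [grad_relation, linPart_eq_sum]
    simp only [← jacobian_eq, hc, Matrix.one_apply]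
    simp [apply_ite, tvec]
  · rintro ⟨h1, h2⟩
    refine ⟨h1, fun u => (mem_derived_iff _).mpr fun i => ?_⟩
    rw [map_sub, Pi.sub_apply, map_sub, grad_apply h1 h2, h2.constantCoeff_mulVec, sub_self]

theorem grad_apply_of_mem_IA [CharZero K] {φ : Fhat m K ≃L[K] Fhat m K} (hφ : φ ∈ IA m K)
    (x : Fhat m K) : grad (φ x) = jacobian φ *ᵥ grad x :=
  grad_apply hφ.1 (mem_IA_iff.mp hφ).2 x

theorem jacobian_of_grad_eq {φ : Fhat m K ≃L[K] Fhat m K}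
    {J : Matrix (Fin m) (Fin m) (MvPowerSeries (Fin m) K)}
    (h : ∀ x, grad (φ x) = J *ᵥ grad x) : jacobian φ = J := by
  ext1 i j
  rw [jacobian_eq, h, grad_gen, mulVec_single_one]
  rfl

theorem jacobian_injOn [CharZero K] {φ ψ : Fhat m K ≃L[K] Fhat m K} (hφ : φ ∈ IA m K)
    (hψ : ψ ∈ IA m K) (h : jacobian φ = jacobian ψ) : φ = ψ :=
  ContinuousLinearEquiv.ext (funext fun x => grad_injective (by
    rw [grad_apply_of_mem_IA hφ, grad_apply_of_mem_IA hψ, h]))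

theorem jacobian_mul [CharZero K] {φ ψ : Fhat m K ≃L[K] Fhat m K} (hφ : φ ∈ IA m K)
    (hψ : ψ ∈ IA m K) : jacobian (φ * ψ) = jacobian φ * jacobian ψ :=
  jacobian_of_grad_eq fun x => by
    change grad (φ (ψ x)) = _
    rw [grad_apply_of_mem_IA hφ, grad_apply_of_mem_IA hψ, mulVec_mulVec]

theorem jacobian_one : jacobian (1 : Fhat m K ≃L[K] Fhat m K) = 1 :=
  jacobian_of_grad_eq fun x => by
    rw [one_mulVec]
    rfl

/-- The admissible matrices are exactly the Jacobian matrices of IA-automorphisms. -/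
theorem exists_mem_IA_of_matrix [CharZero K]
    {J : Matrix (Fin m) (Fin m) (MvPowerSeries (Fin m) K)} (hJ : IsIAMatrix J) :
    ∃ φ ∈ IA m K, jacobian φ = J := by
  obtain ⟨J', hJ', h1, h2⟩ := hJ.exists_inverse
  obtain ⟨φ, hφ⟩ := exists_linearMap_of_matrix hJ
  obtain ⟨ψ, hψ⟩ := exists_linearMap_of_matrix hJ'
  let e : Fhat m K ≃L[K] Fhat m K :=
    { φ with
      invFun := ψ
      left_inv := fun x => grad_injective (by
        change grad (ψ (φ x)) = _
        rw [hψ, hφ, mulVec_mulVec, h2, one_mulVec])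
      right_inv := fun x => grad_injective (by
        change grad (φ (ψ x)) = _
        rw [hφ, hψ, mulVec_mulVec, h1, one_mulVec])
      continuous_toFun := continuous_of_grad_eq_mulVec hφ
      continuous_invFun := continuous_of_grad_eq_mulVec hψ }
  have he : ∀ x, grad (e x) = J *ᵥ grad x := hφ
  have hjac := jacobian_of_grad_eq he
  exact ⟨e, mem_IA_iff.mpr ⟨mem_contAut_of_grad_eq_mulVec hJ he, by rwa [hjac]⟩, hjac⟩

/-- The Jacobian matrix of `exp(ad u)`. -/
def expAdMatrix (u : Fhat m K) : Matrix (Fin m) (Fin m) (MvPowerSeries (Fin m) K) :=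
  expLin (fun i => MvPowerSeries.constantCoeff (grad u i)) • 1
    - vecMulVec (expQuot (fun i => MvPowerSeries.constantCoeff (grad u i)) • grad u) tvec

theorem linPart_eq_linSeries (f : Fin m → MvPowerSeries (Fin m) K) :
    linPart f = linSeries fun i => MvPowerSeries.constantCoeff (f i) := rfl

theorem isInnMatrix_expAdMatrix (u : Fhat m K) : IsInnMatrix (expAdMatrix u) := by
  refine ⟨_, _, ?_, rfl⟩
  rw [dotProduct_smul, tvec_dotProduct_grad, linPart_eq_linSeries, expLin_eq, smul_eq_mul]
  ring

theorem grad_iterate_succ (u v : Fhat m K) (k : ℕ) (i : Fin m) :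
    grad ((fun w : Fhat m K => ⁅w, u⁆)^[k + 1] v) i
      = linPart (grad u) ^ k * (grad v i * linPart (grad u) - grad u i * linPart (grad v)) := by
  induction k generalizing i with
  | zero => simp [grad_lie]
  | succ k ih =>
    rw [Function.iterate_succ_apply', grad_lie, ih]
    have : linPart (grad ((fun w : Fhat m K => ⁅w, u⁆)^[k + 1] v)) = 0 := by
      refine linPart_eq_zero fun j => ?_
      rw [ih]
      simp [constantCoeff_linPart]
    rw [this]
    ring

/-- The exponential series of `ad u` converges to the automorphism with matrix `expAdMatrix u`. -/
theorem isExpAd_of_grad_eq [CharZero K] {u : Fhat m K} {φ : Fhat m K ≃L[K] Fhat m K}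
    (hφ : ∀ x, grad (φ x) = expAdMatrix u *ᵥ grad x) : IsExpAd u φ := by
  intro v
  rw [HasSum, SummationFilter.unconditional_filter, tendsto_nhds_iff]
  intro N
  filter_upwards [eventually_ge_atTop (Finset.range (N + 1))] with S hS
  refine (proj_eq_iff N _ _).mpr fun i => ?_
  set β : Fin m → K := fun i => MvPowerSeries.constantCoeff (grad u i) with hβ
  have hlin : linPart (grad u) = linSeries β := rfl
  set D := grad v i * linPart (grad u) - grad u i * linPart (grad v) with hD
  have hterm : ∀ k, grad ((((k + 1).factorial : ℕ) : K)⁻¹ •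
      (fun w : Fhat m K => ⁅w, u⁆)^[k + 1] v) i
      = ((((k + 1).factorial : ℕ) : K)⁻¹ • linSeries β ^ k) * D := by
    intro k
    rw [map_smul, Pi.smul_apply, grad_iterate_succ, smul_mul_assoc, hD, hlin]
  have hS' : AgreeBelow N
      (grad (∑ k ∈ S, ((k.factorial : ℕ) : K)⁻¹ • (fun w : Fhat m K => ⁅w, u⁆)^[k] v) i)
      (grad (∑ k ∈ Finset.range (N + 1),
        ((k.factorial : ℕ) : K)⁻¹ • (fun w : Fhat m K => ⁅w, u⁆)^[k] v) i) := by
    intro d hd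
    simp only [map_sum, Finset.sum_apply]
    refine (Finset.sum_subset hS fun k _ hk => ?_).symm
    -- the summands of index greater than `N` have no terms of degree less than `N`
    obtain ⟨k, rfl⟩ : ∃ l, k = l + 1 := ⟨k - 1, by
      have := Finset.mem_range.not.mp hk
      omega⟩
    have hNk : N ≤ k := by
      have := Finset.mem_range.not.mp hk
      omega
    have h0 : AgreeBelow N (((((k + 1).factorial : ℕ) : K)⁻¹ • linSeries β ^ k) * D) 0 := by
      have := ((AgreeBelow.refl N (MvPowerSeries.C (((k + 1).factorial : K)⁻¹))).mul
        (agreeBelow_linSeries_pow β hNk)).mul (AgreeBelow.refl N D)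
      rwa [mul_zero, zero_mul, ← MvPowerSeries.smul_eq_C_mul] at this
    rw [hterm, h0 d hd, map_zero]
  refine hS'.trans ?_
  rw [map_sum, Finset.sum_apply, Finset.sum_range_succ', Finset.sum_congr rfl fun k _ => hterm k,
    ← Finset.sum_mul]
  have hE := (evalLin_agree (fun n => ((n + 1).factorial : K)⁻¹) β N).symm
  refine ((hE.mul (AgreeBelow.refl N D)).add (AgreeBelow.refl N _)).trans ?_
  have hval : grad (φ v) i = expQuot β * D + grad v i := by
    rw [hφ, expAdMatrix, sub_mulVec, smul_mulVec, one_mulVec, vecMulVec_mulVec,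
      tvec_dotProduct_grad, ← hβ, expLin_eq, hD, hlin]
    simp only [Pi.sub_apply, Pi.smul_apply, smul_eq_mul, MulOpposite.smul_eq_mul_unop,
      MulOpposite.unop_op]
    ring
  rw [hval]
  simp only [Nat.factorial_zero, Nat.cast_one, inv_one, one_smul, Function.iterate_zero, id]
  exact AgreeBelow.refl _ _

theorem exists_isExpAd [CharZero K] (u : Fhat m K) :
    ∃ φ ∈ IA m K, jacobian φ = expAdMatrix u ∧ IsExpAd u φ := by
  obtain ⟨φ, hφ, hj⟩ := exists_mem_IA_of_matrix (isInnMatrix_expAdMatrix u).isIAMatrix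
  exact ⟨φ, hφ, hj, isExpAd_of_grad_eq fun x => by rw [grad_apply_of_mem_IA hφ, hj]⟩

theorem IsExpAd.unique {u : Fhat m K} {φ ψ : Fhat m K ≃L[K] Fhat m K} (hφ : IsExpAd u φ)
    (hψ : IsExpAd u ψ) : φ = ψ :=
  ContinuousLinearEquiv.ext (funext fun v => (hφ v).unique (hψ v))

/-- A matrix `e^ℓ - w t` with `t w = e^ℓ - 1` is the matrix of `exp(ad u)`, where the gradient of
`u` is `w ℓ / (e^ℓ - 1)`. -/
theorem exists_expAdMatrix_eq [CharZero K] {M : Matrix (Fin m) (Fin m) (MvPowerSeries (Fin m) K)}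
    (hM : IsInnMatrix M) : ∃ u : Fhat m K, expAdMatrix u = M := by
  obtain ⟨β, w, hw, rfl⟩ := hM
  have hunit : IsUnit (expQuot β) := by
    rw [MvPowerSeries.isUnit_iff_constantCoeff, constantCoeff_expQuot]
    exact isUnit_one
  obtain ⟨E, hE⟩ := hunit.exists_left_inv
  have hE0 : MvPowerSeries.constantCoeff E = 1 := by
    have := congrArg MvPowerSeries.constantCoeff hE
    rwa [map_mul, constantCoeff_expQuot, mul_one, map_one] at this
  have hc : ∀ i, MvPowerSeries.constantCoeff ((E • w) i) = β i := fun i => by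
    rw [Pi.smul_apply, smul_eq_mul, map_mul, hE0, one_mul, constantCoeff_of_dotProduct hw]
  obtain ⟨u, hu⟩ := exists_grad_eq (E • w) (by
    change tvec ⬝ᵥ (E • w) = _
    rw [dotProduct_smul, hw, linPart_eq_linSeries, funext hc, expLin_eq, smul_eq_mul]
    linear_combination linSeries β * hE)
  refine ⟨u, ?_⟩
  rw [expAdMatrix, hu, funext hc, smul_smul, mul_comm, hE, one_smul]

/-- The inner automorphisms are the IA-automorphisms whose Jacobian matrix is `e^ℓ - w t`. -/
theorem mem_Inn_iff [CharZero K] {φ : Fhat m K ≃L[K] Fhat m K} :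
    φ ∈ Inn m K ↔ φ ∈ IA m K ∧ IsInnMatrix (jacobian φ) := by
  constructor
  · rintro ⟨-, u, hu⟩
    obtain ⟨ψ, hψ, hj, hexp⟩ := exists_isExpAd u
    obtain rfl := hu.unique hexp
    exact ⟨hψ, by rw [hj]; exact isInnMatrix_expAdMatrix u⟩
  · rintro ⟨hφ, hM⟩
    obtain ⟨u, hu⟩ := exists_expAdMatrix_eq hM
    obtain ⟨ψ, hψ, hj, hexp⟩ := exists_isExpAd u
    obtain rfl := jacobian_injOn hφ hψ (by rw [hj, hu])
    exact ⟨hφ.1, u, hexp⟩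

theorem Inn_subset_IA [CharZero K] : Inn m K ⊆ IA m K := fun _ h => (mem_Inn_iff.mp h).1

theorem one_mem_Inn [CharZero K] : 1 ∈ Inn m K :=
  mem_Inn_iff.mpr ⟨one_mem _, by rw [jacobian_one]; exact IsInnMatrix.one⟩

theorem mul_mem_Inn [CharZero K] {φ ψ : Fhat m K ≃L[K] Fhat m K} (hφ : φ ∈ Inn m K)
    (hψ : ψ ∈ Inn m K) : φ * ψ ∈ Inn m K := by
  rw [mem_Inn_iff] at *
  exact ⟨mul_mem hφ.1 hψ.1, by rw [jacobian_mul hφ.1 hψ.1]; exact hφ.2.mul hψ.2⟩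

theorem inv_mem_Inn [CharZero K] {φ : Fhat m K ≃L[K] Fhat m K} (hφ : φ ∈ Inn m K) :
    φ⁻¹ ∈ Inn m K := by
  rw [mem_Inn_iff] at *
  refine ⟨inv_mem hφ.1, ?_⟩
  obtain ⟨M', hM', h⟩ := hφ.2.exists_inverse
  have h2 := jacobian_mul hφ.1 (inv_mem hφ.1)
  rw [mul_inv_cancel, jacobian_one] at h2
  rwa [← left_inv_eq_right_inv h h2.symm]

theorem conj_mem_Inn [CharZero K] {φ ψ : Fhat m K ≃L[K] Fhat m K} (hφ : φ ∈ Inn m K)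
    (hψ : ψ ∈ IA m K) : ψ * φ * ψ⁻¹ ∈ Inn m K := by
  rw [mem_Inn_iff] at *
  refine ⟨mul_mem (mul_mem hψ hφ.1) (inv_mem hψ), ?_⟩
  have h2 := jacobian_mul hψ (inv_mem hψ)
  rw [mul_inv_cancel, jacobian_one] at h2
  rw [jacobian_mul (mul_mem hψ hφ.1) (inv_mem hψ), jacobian_mul hψ hφ.1]
  exact hφ.2.conj (mem_IA_iff.mp hψ).2 h2.symm (mem_IA_iff.mp (inv_mem hψ)).2

variable (m K) in
/-- The inner automorphisms as a subgroup of the group of IA-automorphisms. -/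
def innSubgroup [CharZero K] : Subgroup (IA m K) where
  carrier := {φ | (φ : Fhat m K ≃L[K] Fhat m K) ∈ Inn m K}
  one_mem' := one_mem_Inn
  mul_mem' := mul_mem_Inn
  inv_mem' := inv_mem_Inn

theorem Theta_subset_IA [CharZero K] (hm : 2 ≤ m) : Theta m K hm ⊆ IA m K :=
  fun _ h => mem_IA_iff.mpr ⟨h.1, h.2.isIAMatrix⟩

theorem exists_inn_mul_mem_Theta [CharZero K] (hm : 2 ≤ m) {φ : Fhat m K ≃L[K] Fhat m K}
    (hφ : φ ∈ IA m K) : ∃ ψ ∈ Inn m K, ψ * φ ∈ Theta m K hm := by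
  obtain ⟨M, hM, hnf⟩ := exists_inn_mul_hasNormalForm hm (mem_IA_iff.mp hφ).2
  obtain ⟨ψ, hψ, rfl⟩ := exists_mem_IA_of_matrix hM.isIAMatrix
  exact ⟨ψ, mem_Inn_iff.mpr ⟨hψ, hM⟩, (mul_mem hψ hφ).1, by rwa [jacobian_mul hψ hφ]⟩

theorem eq_of_inn_mul_mem_Theta [CharZero K] {hm : 2 ≤ m} {ψ θ : Fhat m K ≃L[K] Fhat m K}
    (hψ : ψ ∈ Inn m K) (hθ : θ ∈ Theta m K hm) (h : ψ * θ ∈ Theta m K hm) : ψ * θ = θ := by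
  have hθ' := Theta_subset_IA hm hθ
  rw [mem_Inn_iff] at hψ
  refine jacobian_injOn (mul_mem hψ.1 hθ') hθ' ?_
  have h2 := h.2
  rw [jacobian_mul hψ.1 hθ'] at h2 ⊢
  exact hasNormalForm_unique hψ.2 hθ.2 h2

end automorphisms

end FreeMetab

end

theorem theorem2p3 (m : ℕ) (hm : 2 ≤ m) (K : Type*) [Field K] [CharZero K] :
    -- `Inn` is a normal subgroup of `IA` and contains `exp(ad u)` for every `u`
    ∃ N : Subgroup (FreeMetab.IA m K),
      N.Normal ∧
      (Subtype.val '' (N : Set (FreeMetab.IA m K)) = FreeMetab.Inn m K) ∧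
      (∀ u : FreeMetab.Fhat m K, ∃ φ ∈ FreeMetab.Inn m K, FreeMetab.IsExpAd u φ) ∧
      -- `Θ` lies in `IA`, which is the disjoint union of the cosets `Inn θ`, `θ ∈ Θ`
      FreeMetab.Theta m K hm ⊆ FreeMetab.IA m K ∧
      (⋃ θ ∈ FreeMetab.Theta m K hm, (fun φ => φ * θ) '' FreeMetab.Inn m K
        = (FreeMetab.IA m K : Set (FreeMetab.Fhat m K ≃L[K] FreeMetab.Fhat m K))) ∧
      (FreeMetab.Theta m K hm).PairwiseDisjoint (fun θ => (fun φ => φ * θ) '' FreeMetab.Inn m K) ∧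
      -- every element of the quotient group `IA / Inn` has exactly one representative in `Θ`
      (∀ c : FreeMetab.IA m K ⧸ N, ∃! θ : FreeMetab.IA m K,
        (θ : FreeMetab.Fhat m K ≃L[K] FreeMetab.Fhat m K) ∈ FreeMetab.Theta m K hm ∧
          (QuotientGroup.mk θ : FreeMetab.IA m K ⧸ N) = c) := by
  open FreeMetab in
  have hnormal : (innSubgroup m K).Normal := ⟨fun φ hφ ψ => conj_mem_Inn hφ ψ.2⟩
  refine ⟨innSubgroup m K, hnormal, ?_, fun u => ?_, Theta_subset_IA hm, ?_, ?_, fun c => ?_⟩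
  · exact Set.Subset.antisymm (by rintro _ ⟨φ, hφ, rfl⟩; exact hφ)
      fun φ hφ => ⟨⟨φ, Inn_subset_IA hφ⟩, hφ, rfl⟩
  · obtain ⟨φ, hφ, hj, hexp⟩ := exists_isExpAd u
    exact ⟨φ, ⟨hφ.1, u, hexp⟩, hexp⟩
  · refine Set.Subset.antisymm (Set.iUnion₂_subset fun θ hθ => ?_) fun φ hφ => ?_
    · rintro _ ⟨φ, hφ, rfl⟩
      exact mul_mem (Inn_subset_IA hφ) (Theta_subset_IA hm hθ)
    · obtain ⟨ψ, hψ, hθ⟩ := exists_inn_mul_mem_Theta hm hφ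
      exact Set.mem_iUnion₂.mpr ⟨_, hθ, ψ⁻¹, inv_mem_Inn hψ, inv_mul_cancel_left ψ φ⟩
  · intro θ hθ θ' hθ' hne
    refine Set.disjoint_left.mpr ?_
    rintro _ ⟨φ, hφ, rfl⟩ ⟨ψ, hψ, h⟩
    refine hne ?_
    have h2 : ψ⁻¹ * φ * θ = θ' := by
      rw [mul_assoc, inv_mul_eq_iff_eq_mul]
      exact h.symm
    rw [← h2]
    exact (eq_of_inn_mul_mem_Theta (mul_mem_Inn (inv_mem_Inn hψ) hφ) hθ (by rwa [h2])).symm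
  · obtain ⟨φ, rfl⟩ := QuotientGroup.mk_surjective c
    obtain ⟨ψ, hψ, hθ⟩ := exists_inn_mul_mem_Theta hm φ.2
    have hmk : ∀ ψ φ : IA m K, ψ ∈ innSubgroup m K →
        (QuotientGroup.mk (ψ * φ) : IA m K ⧸ innSubgroup m K) = QuotientGroup.mk φ := by
      intro ψ φ hψ
      rw [QuotientGroup.mk_mul, (QuotientGroup.eq_one_iff ψ).mpr hψ, one_mul]
    refine ⟨⟨ψ, Inn_subset_IA hψ⟩ * φ, ⟨hθ, hmk _ _ hψ⟩, ?_⟩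
    rintro θ' ⟨hθ', hc⟩
    have h3 : (QuotientGroup.mk θ' : IA m K ⧸ innSubgroup m K)
        = QuotientGroup.mk (⟨ψ, Inn_subset_IA hψ⟩ * φ) := hc.trans (hmk _ _ hψ).symm
    have h4 : θ' * (⟨ψ, Inn_subset_IA hψ⟩ * φ)⁻¹ ∈ innSubgroup m K := by
      rw [← QuotientGroup.eq_one_iff, QuotientGroup.mk_mul, QuotientGroup.mk_inv, h3,
        mul_inv_cancel]
    have h5 := eq_of_inn_mul_mem_Theta h4 hθ (by
      have : ((θ' * (⟨ψ, Inn_subset_IA hψ⟩ * φ)⁻¹ : IA m K) : Fhat m K ≃L[K] Fhat m K) * (ψ * φ)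
          = θ' := by
        change ((θ' : Fhat m K ≃L[K] Fhat m K) * (ψ * φ)⁻¹) * (ψ * φ) = θ'
        rw [inv_mul_cancel_right]
      rwa [this])
    refine Subtype.ext ?_
    change (θ' : Fhat m K ≃L[K] Fhat m K) = ψ * φ
    rw [← h5]
    change _ = ((θ' : Fhat m K ≃L[K] Fhat m K) * (ψ * φ)⁻¹) * (ψ * φ)
    rw [inv_mul_cancel_right]
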